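/- Let $\delta>0$ and $|\theta_0|<2^{\frac{1}{4+2\delta}-1}$. Let $W_1,W_2,\dots$ be i.i.d. standard Gaussian, let $X_0$ be independent of $(W_n)$ with law $q^{(0)}$ (given by a density with respect to some reference measure on $\mathbb R$) and $E|X_0|^{4+2\delta}<\infty$, and let $X_n=\theta_0X_{n-1}+W_n$ for $n\ge1$. For $\theta\in\Theta=(-1,1)$ let $p_\theta(y|x)$ be the density of $N(\theta x,1)$ and $q_\theta$ the density of the invariant law $N(0,\frac1{1-\theta^2})$ of the corresponding chain. Let $P^{(n)}_\theta$ be the law of $(X_0,\dots,X_n)$ under $\theta$ with initial law $q^{(0)}$, with density $p^{(n)}_\theta(x_0,\dots,x_n)=q^{(0)}(x_0)\prod_{i<n}p_\theta(x_{i+1}|x_i)$, and let $r_n(\theta,\theta_0)=\log\big(p^{(n)}_{\theta_0}/p^{(n)}_\theta\big)$. Write $\mathcal K$ for the Kullback–Leibler divergence. Let $\mathcal F$ be the set of Beta distributions (with arbitrary positive parameters) rescaled to $(-1,1)$, and $\pi$ the uniform distribution on $(-1,1)$. Then there are $\rho_n\in\mathcal F$ $(n\ge1)$ such that both of the following hold.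 (A) The process $(X_n)$ is a time-homogeneous Markov chain with transition density $p_{\theta_0}$ and initial law $q^{(0)}$. The chain is aperiodic, and there are $m\in\mathbb N$, positive measurable functions $M^{(1)}_k(x_1,x_0)$, $M^{(2)}_k(x)$, functions $f^{(1)}_k,f^{(2)}_k$ on $\Theta\times\Theta$ $(1\le k\le m)$ and a measurable $V:\mathbb R\to[1,\infty)$ with: 1. for all $\theta_1,\theta_2\in\Theta$ and all $x_0,x_1,x$: $|\log p_{\theta_1}(x_1|x_0)-\log p_{\theta_2}(x_1|x_0)|\le\sum_kM^{(1)}_k(x_1,x_0)|f^{(1)}_k(\theta_2,\theta_1)|$ and $|\log q_{\theta_1}(x)-\log q_{\theta_2}(x)|\le\sum_kM^{(2)}_k(x)|f^{(2)}_k(\theta_2,\theta_1)|$; 2. for $t\in\{1,2\}$ and each $k$ there is $C^{(t)}_k$ with $\int|f^{(t)}_k(\theta,\theta_0)|^{2+\delta}\rho_n(d\theta)<C^{(t)}_k/n$ for all $n\ge1$; 3. there is $B$ with $\int\!\!\int M^{(1)}_k(x_1,x_0)^{2+\delta}p_\theta(x_1|x_0)\,dx_1\,q^{(0)}(dx_0)<B$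 for all $k$ and all $\theta\in\Theta$; 4. the chain under $\theta_0$ is $V$-geometrically ergodic: it is positive Harris recurrent, and there is $r>1$ with $\sum_{n\ge1}r^n\,\|P_{\theta_0}(X_n\in\cdot\mid X_0=x)-q_{\theta_0}\|_V<\infty$ for every $x$, where $\|v\|_V=\sup_{|g|<V}|\int g\,dv|$; 5. $\int M^{(1)}_k(y,x)^{2+\delta}p_{\theta_0}(y|x)\,dy<V(x)$ for all $k,x$, and $E_{q^{(0)}}[V(X_0)]<\infty$. Moreover, there is $C>0$ with $\mathcal K(\rho_n,\pi)\le C\sqrt n$ for all $n\ge1$. (B) There are $\varepsilon_n>0$ with $\varepsilon_n=O\big(\max(n^{-1/2},n^{\delta/2-1})\big)$ such that for all $n\ge1$, with expectations and variances under $P^{(n)}_{\theta_0}$: $r_n(\theta,\theta_0)$ is square integrable for every $\theta\in\Theta$; $\int\mathcal K(P^{(n)}_{\theta_0},P^{(n)}_\theta)\rho_n(d\theta)=\int E[r_n(\theta,\theta_0)]\rho_n(d\theta)\le n\varepsilon_n$; $\int\mathrm{Var}(r_n(\theta,\theta_0))\rho_n(d\theta)\le n\varepsilon_n$; and $\mathcal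 K(\rho_n,\pi)\le n\varepsilon_n$. -/

import Mathlib

open MeasureTheory ProbabilityTheory Filter Asymptotics
open scoped ENNReal NNReal Topology

namespace MarkovVB

noncomputable section

/-! ### General state space Markov chains -/

/-- The law on path space of the time-homogeneous Markov chain with one-step transition
kernel `κ` and initial law `ν`. -/
def chainLaw {S : Type*} [MeasurableSpace S] (κ : Kernel S S) [IsMarkovKernel κ]
    (ν : Measure S) : Measure (ℕ → S) :=
  Kernel.trajMeasure (X := fun _ : ℕ => S) ν
    (fun n => κ.comap
      (fun h : (i : Finset.Iic n) → S => h ⟨n, Finset.mem_Iic.2 le_rfl⟩)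
      (measurable_pi_apply _))

/-- `φ` is an irreducibility measure: it is non-trivial, and every set which it charges is reached
with positive probability, at some time `n ≥ 1`, from every starting point. -/
def IsIrreducibilityMeasure {S : Type*} [MeasurableSpace S] (κ : Kernel S S)
    (φ : Measure S) : Prop :=
  φ ≠ 0 ∧ ∀ A : Set S, MeasurableSet A → 0 < φ A → ∀ x : S, ∃ n : ℕ, 1 ≤ n ∧ 0 < (κ ^ n) x A

/-- The chain is `ψ`-irreducible, where `ψ` is a maximal irreducibility measure. -/
def IsMaximalIrreducibilityMeasure {S : Type*} [MeasurableSpace S] (κ : Kernel S S)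
    (ψ : Measure S) : Prop :=
  IsIrreducibilityMeasure κ ψ ∧ ∀ φ : Measure S, IsIrreducibilityMeasure κ φ → φ ≪ ψ

/-- The sets `D i` (with cyclic index) form a `d`-cycle, up to a `ψ`-null set. -/
def IsCycle {S : Type*} [MeasurableSpace S] (κ : Kernel S S) (ψ : Measure S) (d : ℕ)
    (D : ZMod d → Set S) : Prop :=
  (∀ i, MeasurableSet (D i)) ∧ (∀ i j, i ≠ j → Disjoint (D i) (D j)) ∧
    (∀ i, ∀ x ∈ D i, κ x (D (i + 1)) = 1) ∧ ψ (⋃ i, D i)ᶜ = 0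

/-- A `ψ`-irreducible chain is aperiodic when the largest `d` for which there is a `d`-cycle
is `1`. -/
def IsAperiodic {S : Type*} [MeasurableSpace S] (κ : Kernel S S) : Prop :=
  ∃ ψ : Measure S, IsMaximalIrreducibilityMeasure κ ψ ∧
    ∀ d : ℕ, 2 ≤ d → ¬ ∃ D : ZMod d → Set S, IsCycle κ ψ d D

/-- Harris recurrence: the chain is `ψ`-irreducible and from every starting point it visits every
set of positive `ψ`-measure infinitely often, almost surely. -/
def IsHarrisRecurrent {S : Type*} [MeasurableSpace S] (κ : Kernel S S) [IsMarkovKernel κ] :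
    Prop :=
  ∃ ψ : Measure S, IsMaximalIrreducibilityMeasure κ ψ ∧
    ∀ A : Set S, MeasurableSet A → 0 < ψ A → ∀ x : S,
      ∀ᵐ ω ∂(chainLaw κ (Measure.dirac x)), ∃ᶠ n in atTop, ω n ∈ A

/-- Positive Harris: Harris recurrent with an invariant probability measure. -/
def IsPositiveHarris {S : Type*} [MeasurableSpace S] (κ : Kernel S S) [IsMarkovKernel κ] :
    Prop :=
  IsHarrisRecurrent κ ∧ ∃ μ : Measure S, IsProbabilityMeasure μ ∧ Kernel.Invariant κ μ

open Classical in
/-- The `f`-norm `‖μ - ν‖_f = sup_{|g| < f} |∫ g dμ - ∫ g dν|` of the difference of two measures;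
it is infinite if one of the integrals does not exist. -/
def fDist {S : Type*} [MeasurableSpace S] (f : S → ℝ) (μ ν : Measure S) : ℝ≥0∞ :=
  ⨆ g : S → ℝ, ⨆ _ : Measurable g, ⨆ _ : ∀ x, |g x| < f x,
    if Integrable g μ ∧ Integrable g ν then
      ENNReal.ofReal |(∫ x, g x ∂μ) - ∫ x, g x ∂ν|
    else ⊤

/-- `V`-geometric ergodicity with invariant law `μ`: the chain is positive Harris, and there is
`r > 1` with `∑_{n ≥ 1} r ^ n ‖κ ^ n (x, ·) - μ‖_V < ∞` for every state `x`. -/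
def IsVGeometricallyErgodic {S : Type*} [MeasurableSpace S] (κ : Kernel S S)
    [IsMarkovKernel κ] (μ : Measure S) (V : S → ℝ) : Prop :=
  IsPositiveHarris κ ∧ IsProbabilityMeasure μ ∧ Kernel.Invariant κ μ ∧
    ∃ r : ℝ, 1 < r ∧ ∀ x : S,
      ∑' n : ℕ, ENNReal.ofReal (r ^ (n + 1)) * fDist V ((κ ^ (n + 1)) x) μ < ⊤

/-! ### Parametrized Markov models -/

/-- The data of a parametrized family of Markov chains on `S` with parameter space
`paramSet ⊆ E` and with a known initial density, common to all parameters.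
`transDensity θ x y` is `p_θ(y | x)`, and `invDensity θ` is `q_θ`. -/
structure Model (S E : Type*) [MeasurableSpace S] where
  paramSet : Set E
  kernel : E → Kernel S S
  isMarkov : ∀ θ, IsMarkovKernel (kernel θ)
  ref : Measure S
  transDensity : E → S → S → ℝ
  invDensity : E → S → ℝ
  initRef : Measure S
  initDensity : S → ℝ

namespace Model

variable {S E : Type*} [MeasurableSpace S]

instance (M : Model S E) (θ : E) : IsMarkovKernel (M.kernel θ) := M.isMarkov θ

/-- The initial law `q⁽⁰⁾`. -/
def initLaw (M : Model S E) : Measure S :=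
  M.initRef.withDensity (fun x => ENNReal.ofReal (M.initDensity x))

/-- The law with density `q_θ`. -/
def invLaw (M : Model S E) (θ : E) : Measure S :=
  M.ref.withDensity (fun x => ENNReal.ofReal (M.invDensity θ x))

/-- The functions in the model are what they are called: `p_θ(· | x)` is the density of the
transition kernel, `q_θ` is the density of an invariant probability measure under `θ`, and the
initial density is a probability density. -/
structure IsConsistent (M : Model S E) : Prop where
  init_nonneg : ∀ x, 0 ≤ M.initDensity x
  init_measurable : Measurable M.initDensity
  init_prob : IsProbabilityMeasure M.initLaw
  trans_nonneg : ∀ θ ∈ M.paramSet, ∀ x y, 0 ≤ M.transDensity θ x y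
  trans_measurable : ∀ θ ∈ M.paramSet, Measurable (Function.uncurry (M.transDensity θ))
  kernel_eq : ∀ θ ∈ M.paramSet, ∀ x,
    M.kernel θ x = M.ref.withDensity (fun y => ENNReal.ofReal (M.transDensity θ x y))
  inv_nonneg : ∀ θ ∈ M.paramSet, ∀ x, 0 ≤ M.invDensity θ x
  inv_measurable : ∀ θ ∈ M.paramSet, Measurable (M.invDensity θ)
  inv_prob : ∀ θ ∈ M.paramSet, IsProbabilityMeasure (M.invLaw θ)
  inv_invariant : ∀ θ ∈ M.paramSet, Kernel.Invariant (M.kernel θ) (M.invLaw θ)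

/-- `P_θ⁽ⁿ⁾`, the law of `(X_0, …, X_n)` under `θ`. -/
def pathLaw (M : Model S E) (θ : E) (n : ℕ) : Measure (Fin (n + 1) → S) :=
  (chainLaw (M.kernel θ) M.initLaw).map (fun ω (i : Fin (n + 1)) => ω i)

/-- `p_θ⁽ⁿ⁾(x_0, …, x_n) = q⁽⁰⁾(x_0) ∏_{i < n} p_θ(x_{i+1} | x_i)`. -/
def pathDensity (M : Model S E) (θ : E) (n : ℕ) (x : Fin (n + 1) → S) : ℝ :=
  M.initDensity (x 0) * ∏ i : Fin n, M.transDensity θ (x i.castSucc) (x i.succ)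

/-- The log-likelihood ratio `r_n(θ, θ₀) = log (p_{θ₀}⁽ⁿ⁾ / p_θ⁽ⁿ⁾)`. -/
def logRatio (M : Model S E) (n : ℕ) (θ θ₀ : E) (x : Fin (n + 1) → S) : ℝ :=
  Real.log (M.pathDensity θ₀ n x / M.pathDensity θ n x)

/-- The generalized Lipschitz assumption, with `m` functions `M⁽¹⁾_k`, `M⁽²⁾_k`, `f⁽¹⁾_k`,
`f⁽²⁾_k`, exponent `δ`, true parameter `θ₀` and measures `ρ_n`. -/
structure GenLipschitz [MeasurableSpace E] (M : Model S E) (θ₀ : E) (δ : ℝ)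
    (ρ : ℕ → Measure E) (m : ℕ) (M₁ : Fin m → S → S → ℝ) (M₂ : Fin m → S → ℝ)
    (f₁ f₂ : Fin m → E → E → ℝ) : Prop where
  pos₁ : ∀ k y x, 0 < M₁ k y x
  pos₂ : ∀ k x, 0 < M₂ k x
  measurable₁ : ∀ k, Measurable (Function.uncurry (M₁ k))
  measurable₂ : ∀ k, Measurable (M₂ k)
  lip_trans : ∀ θ₁ ∈ M.paramSet, ∀ θ₂ ∈ M.paramSet, ∀ x₀ x₁ : S,
    |Real.log (M.transDensity θ₁ x₀ x₁) - Real.log (M.transDensity θ₂ x₀ x₁)| ≤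
      ∑ k, M₁ k x₁ x₀ * |f₁ k θ₂ θ₁|
  lip_inv : ∀ θ₁ ∈ M.paramSet, ∀ θ₂ ∈ M.paramSet, ∀ x : S,
    |Real.log (M.invDensity θ₁ x) - Real.log (M.invDensity θ₂ x)| ≤
      ∑ k, M₂ k x * |f₂ k θ₂ θ₁|
  moment_f₁ : ∀ k, ∃ C : ℝ, ∀ n : ℕ, 1 ≤ n →
    Integrable (fun θ => |f₁ k θ θ₀| ^ (2 + δ)) (ρ n) ∧
      ∫ θ, |f₁ k θ θ₀| ^ (2 + δ) ∂(ρ n) < C / n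
  moment_f₂ : ∀ k, ∃ C : ℝ, ∀ n : ℕ, 1 ≤ n →
    Integrable (fun θ => |f₂ k θ θ₀| ^ (2 + δ)) (ρ n) ∧
      ∫ θ, |f₂ k θ θ₀| ^ (2 + δ) ∂(ρ n) < C / n
  moment_M₁ : ∃ B : ℝ, ∀ k, ∀ θ ∈ M.paramSet,
    ∫⁻ x₀, ∫⁻ x₁, ENNReal.ofReal (M₁ k x₁ x₀ ^ (2 + δ)) ∂(M.kernel θ x₀) ∂M.initLaw
      < ENNReal.ofReal B

/-- The hypotheses of the concentration theorem for non-stationary, `V`-geometrically ergodic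
chains, for the data `X` on `(Ω, P)`, the prior `π`, the exponent `δ` and the measures `ρ_n`. -/
structure NonstationaryConditions [MeasurableSpace E] {Ω : Type*} [MeasurableSpace Ω]
    (M : Model S E) (P : Measure Ω) (X : ℕ → Ω → S) (θ₀ : E) (δ : ℝ) (π : Measure E)
    (ρ : ℕ → Measure E) : Prop where
  consistent : M.IsConsistent
  mem_paramSet : θ₀ ∈ M.paramSet
  generated : HasLaw (fun ω n => X n ω) (chainLaw (M.kernel θ₀) M.initLaw) P
  aperiodic : IsAperiodic (M.kernel θ₀)
  lipschitz_ergodic : ∃ (m : ℕ) (M₁ : Fin m → S → S → ℝ) (M₂ : Fin m → S → ℝ)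
      (f₁ f₂ : Fin m → E → E → ℝ) (V : S → ℝ),
    M.GenLipschitz θ₀ δ ρ m M₁ M₂ f₁ f₂ ∧
    Measurable V ∧ (∀ x, 1 ≤ V x) ∧
    IsVGeometricallyErgodic (M.kernel θ₀) (M.invLaw θ₀) V ∧
    (∀ k x, ∫⁻ y, ENNReal.ofReal (M₁ k y x ^ (2 + δ)) ∂(M.kernel θ₀ x)
      < ENNReal.ofReal (V x)) ∧
    ∫⁻ x, ENNReal.ofReal (V x) ∂M.initLaw < ⊤
  kl_prior : ∃ C : ℝ, 0 < C ∧ ∀ n : ℕ, 1 ≤ n →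
    InformationTheory.klDiv (ρ n) π ≤ ENNReal.ofReal (C * √n)

/-- The three conditions of the PAC-Bayes bound at sample size `n`, with rate `ε` and
distribution `ρ`. Expectations and variances are under `P_{θ₀}⁽ⁿ⁾`. -/
structure PACBayesConditions [MeasurableSpace E] (M : Model S E) (θ₀ : E) (π : Measure E)
    (n : ℕ) (ρ : Measure E) (ε : ℝ) : Prop where
  memLp : ∀ θ ∈ M.paramSet, MemLp (M.logRatio n θ θ₀) 2 (M.pathLaw θ₀ n)
  integrable_mean :
    Integrable (fun θ => ∫ x, M.logRatio n θ θ₀ x ∂(M.pathLaw θ₀ n)) ρ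
  kl_eq : ∫⁻ θ, InformationTheory.klDiv (M.pathLaw θ₀ n) (M.pathLaw θ n) ∂ρ =
    ENNReal.ofReal (∫ θ, ∫ x, M.logRatio n θ θ₀ x ∂(M.pathLaw θ₀ n) ∂ρ)
  mean_le : ∫ θ, ∫ x, M.logRatio n θ θ₀ x ∂(M.pathLaw θ₀ n) ∂ρ ≤ n * ε
  integrable_var :
    Integrable (fun θ => variance (M.logRatio n θ θ₀) (M.pathLaw θ₀ n)) ρ
  var_le : ∫ θ, variance (M.logRatio n θ θ₀) (M.pathLaw θ₀ n) ∂ρ ≤ n * ε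
  kl_prior_le : InformationTheory.klDiv ρ π ≤ ENNReal.ofReal (n * ε)

end Model

/-! ### The simple linear model -/

/-- The transition kernel `x ↦ N(θ x, 1)` of `X_n = θ X_{n-1} + W_n`. -/
def ar1Kernel (θ : ℝ) : Kernel ℝ ℝ where
  toFun x := gaussianReal (θ * x) 1
  measurable' := by
    have h : Measurable (fun x : ℝ => (θ * x, (1 : ℝ≥0))) := by fun_prop
    exact measurable_gaussianReal.comp h

lemma isMarkovKernel_ar1Kernel (θ : ℝ) : IsMarkovKernel (ar1Kernel θ) :=
  ⟨fun x => inferInstanceAs (IsProbabilityMeasure (gaussianReal (θ * x) 1))⟩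

/-- The simple linear model `X_n = θ X_{n-1} + W_n` with standard Gaussian noise and parameter
space `(-1, 1)`; the invariant law under `θ` is `N(0, 1 / (1 - θ ^ 2))`. -/
def simpleLinearModel (initRef : Measure ℝ) (initDensity : ℝ → ℝ) : Model ℝ ℝ where
  paramSet := Set.Ioo (-1) 1
  kernel := ar1Kernel
  isMarkov := isMarkovKernel_ar1Kernel
  ref := volume
  transDensity θ x y := gaussianPDFReal (θ * x) 1 y
  invDensity θ x := gaussianPDFReal 0 (Real.toNNReal (1 / (1 - θ ^ 2))) x
  initRef := initRef
  initDensity := initDensity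

/-- The Beta distributions rescaled to `(-1, 1)`: the laws of `2 Y - 1` with
`Y ∼ Beta(a, b)`, `a, b > 0`. -/
def scaledBetaFamily : Set (Measure ℝ) :=
  {ρ | ∃ a b : ℝ, 0 < a ∧ 0 < b ∧ ρ = (betaMeasure a b).map (fun y => 2 * y - 1)}

/-- The uniform distribution on `(-1, 1)`. -/
def uniformPrior : Measure ℝ := ProbabilityTheory.cond volume (Set.Ioo (-1 : ℝ) 1)

end

end MarkovVB

open MarkovVB

namespace MarkovVB

section ChainLaw

variable {S : Type*} [MeasurableSpace S] (κ : Kernel S S) [IsMarkovKernel κ]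
  (ν : Measure S) [IsProbabilityMeasure ν]

instance isProbabilityMeasure_chainLaw : IsProbabilityMeasure (chainLaw κ ν) := by
  unfold chainLaw; infer_instance

/-- Extend a path up to time `n` by one more state. -/
def extendPath (n : ℕ) (p : ((i : Finset.Iic n) → S) × S) : (i : Finset.Iic (n + 1)) → S :=
  fun i => if hi : (i : ℕ) ≤ n then p.1 ⟨i, Finset.mem_Iic.2 hi⟩ else p.2

lemma extendPath_frestrictLe {S : Type*} (n : ℕ) (ω : ℕ → S) :
    extendPath n (Preorder.frestrictLe n ω, ω (n + 1)) = Preorder.frestrictLe (n + 1) ω := by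
  ext i
  unfold extendPath
  split_ifs with h
  · rfl
  · have := Finset.mem_Iic.1 i.2
    have : (i : ℕ) = n + 1 := by omega
    simp [Preorder.frestrictLe, Finset.restrict, this]

lemma measurable_extendPath (n : ℕ) : Measurable (extendPath (S := S) n) := by
  refine measurable_pi_lambda _ fun i => ?_
  unfold extendPath
  split_ifs with h
  · fun_prop
  · fun_prop

lemma lintegral_chainLaw_succ (n : ℕ) {F : ((i : Finset.Iic n) → S) → S → ℝ≥0∞}
    (hF : Measurable (Function.uncurry F)) :
    ∫⁻ ω, F (Preorder.frestrictLe n ω) (ω (n + 1)) ∂(chainLaw κ ν) =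
      ∫⁻ ω, ∫⁻ y, F (Preorder.frestrictLe n ω) y ∂(κ (ω n)) ∂(chainLaw κ ν) := by
  have h := Kernel.map_frestrictLe_trajMeasure_compProd_eq_map_trajMeasure
    (X := fun _ : ℕ => S) (μ₀ := ν) (κ := fun n => κ.comap
      (fun h : (i : Finset.Iic n) → S => h ⟨n, Finset.mem_Iic.2 le_rfl⟩)
      (measurable_pi_apply _)) (a := n)
  change (chainLaw κ ν).map _ ⊗ₘ _ = (chainLaw κ ν).map _ at h
  have h2 := congrArg (fun m => ∫⁻ p, Function.uncurry F p ∂m) h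
  rw [Measure.lintegral_compProd hF, lintegral_map hF (by fun_prop), lintegral_map] at h2
  · exact h2.symm
  · exact hF.lintegral_kernel_prod_right'
  · fun_prop

lemma map_zero_chainLaw (κ : Kernel S S) [IsMarkovKernel κ] (ν : Measure S) :
    (chainLaw κ ν).map (fun ω => ω 0) = ν := by
  have : (fun ω : ℕ → S => ω 0) = (fun h : (i : Finset.Iic 0) → S => h ⟨0, by simp⟩) ∘
      Preorder.frestrictLe 0 := rfl
  rw [this, ← Measure.map_map (by fun_prop) (by fun_prop), chainLaw, Kernel.trajMeasure,
    Measure.map_comp _ _ (by fun_prop), Kernel.traj_map_frestrictLe, Kernel.partialTraj_self,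
    Measure.id_comp, Measure.map_map (by fun_prop) (by fun_prop)]
  exact Measure.map_id

variable {κ ν}

lemma eq_chainLaw_of_lintegral_succ (μ : Measure (ℕ → S)) [IsProbabilityMeasure μ]
    (h0 : μ.map (fun ω => ω 0) = ν)
    (hs : ∀ (n : ℕ) (F : ((i : Finset.Iic n) → S) → S → ℝ≥0∞),
      Measurable (Function.uncurry F) →
      ∫⁻ ω, F (Preorder.frestrictLe n ω) (ω (n + 1)) ∂μ =
        ∫⁻ ω, ∫⁻ y, F (Preorder.frestrictLe n ω) y ∂(κ (ω n)) ∂μ) :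
    μ = chainLaw κ ν := by
  have key : ∀ n, μ.map (Preorder.frestrictLe n) = (chainLaw κ ν).map (Preorder.frestrictLe n) := by
    intro n
    induction n with
    | zero =>
      have : (Preorder.frestrictLe 0 : (ℕ → S) → _) =
          (fun (x : S) (_ : Finset.Iic 0) => x) ∘ (fun ω : ℕ → S => ω 0) := by
        ext ω i
        have := Finset.mem_Iic.1 i.2
        have : (i : ℕ) = 0 := by omega
        simp [Preorder.frestrictLe, Finset.restrict, this]
      rw [this, ← Measure.map_map (by fun_prop) (by fun_prop),
        ← Measure.map_map (by fun_prop) (by fun_prop), h0, map_zero_chainLaw]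
    | succ n ih =>
      refine Measure.ext_of_lintegral _ fun f hf => ?_
      rw [lintegral_map hf (by fun_prop), lintegral_map hf (by fun_prop)]
      have hF : Measurable (Function.uncurry fun h y => f (extendPath n (h, y))) :=
        hf.comp (measurable_extendPath n)
      have e1 := hs n (fun h y => f (extendPath n (h, y))) hF
      have e2 := lintegral_chainLaw_succ κ ν n hF
      simp only [extendPath_frestrictLe] at e1 e2
      rw [e1, e2]
      let G : ((i : Finset.Iic n) → S) → ℝ≥0∞ := fun h =>
        ∫⁻ y, f (extendPath n (h, y)) ∂(κ (h ⟨n, by simp⟩))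
      have hG : Measurable G := by
        let κ' := κ.comap (fun h : (i : Finset.Iic n) → S => h ⟨n, by simp⟩) (by fun_prop)
        exact hF.lintegral_kernel_prod_right' (κ := κ')
      have := congrArg (fun m => ∫⁻ h, G h ∂m) ih
      rwa [lintegral_map hG (by fun_prop), lintegral_map hG (by fun_prop)] at this
  refine IsProjectiveLimit.unique (P := fun I => (chainLaw κ ν).map I.restrict) ?_ fun I => rfl
  intro I
  have hI := I.subset_Iic_sup_id
  change _ = (chainLaw κ ν).map I.restrict
  rw [← Finset.restrict₂_comp_restrict (π := fun _ : ℕ => S) hI,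
    ← Measure.map_map (Finset.measurable_restrict₂ (X := fun _ : ℕ => S) hI) (by fun_prop),
    ← Measure.map_map (Finset.measurable_restrict₂ (X := fun _ : ℕ => S) hI) (by fun_prop)]
  exact congrArg _ (key _)

variable (κ ν)

lemma map_apply_chainLaw (n : ℕ) :
    (chainLaw κ ν).map (fun ω => ω n) = ν.bind (κ ^ n : Kernel S S) := by
  induction n with
  | zero =>
    rw [map_zero_chainLaw, pow_zero]
    exact (Measure.id_comp).symm
  | succ n ih =>
    rw [pow_succ']
    change _ = (κ ∘ₖ (κ ^ n)) ∘ₘ ν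
    rw [← Measure.comp_assoc]
    rw [← ih]
    refine Measure.ext_of_lintegral _ fun f hf => ?_
    rw [lintegral_map hf (by fun_prop), Measure.lintegral_bind (by fun_prop) hf.aemeasurable,
      lintegral_map (hf.lintegral_kernel) (by fun_prop)]
    exact lintegral_chainLaw_succ κ ν n (F := fun _ y => f y) (hf.comp measurable_snd)

lemma lintegral_apply_chainLaw (n : ℕ) {f : S → ℝ≥0∞} (hf : Measurable f) :
    ∫⁻ ω, f (ω n) ∂(chainLaw κ ν) = ∫⁻ x, ∫⁻ y, f y ∂((κ ^ n) x) ∂ν := by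
  rw [← lintegral_map hf (by fun_prop), map_apply_chainLaw,
    Measure.lintegral_bind (by fun_prop) hf.aemeasurable]

lemma condExp_chainLaw [StandardBorelSpace S] [Nonempty S] (n : ℕ) {A : Set S}
    (hA : MeasurableSet A) :
    (chainLaw κ ν)[((fun ω : ℕ → S => ω (n + 1)) ⁻¹' A).indicator (1 : (ℕ → S) → ℝ) |
      Filtration.piLE (X := fun _ => S) n] =ᵐ[chainLaw κ ν] fun ω => (κ (ω n)).real A := by
  have h1 := Kernel.condDistrib_trajMeasure
    (X := fun _ : ℕ => S) (μ₀ := ν) (κ := fun n => κ.comap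
      (fun h : (i : Finset.Iic n) → S => h ⟨n, Finset.mem_Iic.2 le_rfl⟩)
      (measurable_pi_apply _)) (a := n)
  change condDistrib (fun ω : ℕ → S => ω (n + 1)) (Preorder.frestrictLe (π := fun _ : ℕ => S) n)
    (chainLaw κ ν) =ᵐ[(chainLaw κ ν).map _] _ at h1
  have h2 := ae_of_ae_map (Preorder.measurable_frestrictLe (X := fun _ : ℕ => S) n).aemeasurable h1
  have h3 := condDistrib_ae_eq_condExp (μ := chainLaw κ ν) (X := Preorder.frestrictLe (π := fun _ : ℕ => S) n)
    (Y := fun ω : ℕ → S => ω (n + 1))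
    (Preorder.measurable_frestrictLe (X := fun _ : ℕ => S) n) (by fun_prop) hA
  rw [Filtration.piLE_eq_comap_frestrictLe]
  filter_upwards [h2, h3] with ω h2 h3
  rw [h2] at h3
  exact h3.symm

end ChainLaw

section PathDensity

variable {S : Type*} [MeasurableSpace S]

/-- The first `n + 1` states of a path. -/
def initialSegment (S : Type*) (n : ℕ) (ω : ℕ → S) : Fin (n + 1) → S := fun i => ω i

@[fun_prop]
lemma measurable_initialSegment (n : ℕ) : Measurable (initialSegment S n) :=
  measurable_pi_lambda _ fun _ => measurable_pi_apply _

lemma initialSegment_succ {S : Type*} (n : ℕ) (ω : ℕ → S) :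
    initialSegment S (n + 1) ω = Fin.snoc (α := fun _ => S) (initialSegment S n ω) (ω (n + 1)) := by
  ext i
  refine Fin.lastCases ?_ (fun i => ?_) i
  · simp [initialSegment]
  · simp [initialSegment]

lemma measurable_finSnoc (n : ℕ) :
    Measurable fun p : (Fin n → S) × S => Fin.snoc (α := fun _ => S) p.1 p.2 := by
  refine measurable_pi_lambda _ fun i => ?_
  refine Fin.lastCases ?_ (fun i => ?_) i
  · simpa using measurable_snd
  · simp only [Fin.snoc_castSucc]
    fun_prop

lemma lintegral_initialSegment_succ (κ : Kernel S S) [IsMarkovKernel κ]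
    (ν : Measure S) [IsProbabilityMeasure ν] (n : ℕ) {f : (Fin (n + 2) → S) → ℝ≥0∞}
    (hf : Measurable f) :
    ∫⁻ ω, f (initialSegment S (n + 1) ω) ∂(chainLaw κ ν) =
      ∫⁻ ω, ∫⁻ y, f (Fin.snoc (α := fun _ => S) (initialSegment S n ω) y) ∂(κ (ω n))
        ∂(chainLaw κ ν) := by
  simp_rw [initialSegment_succ]
  refine lintegral_chainLaw_succ κ ν n (F := fun h y => f (Fin.snoc (α := fun _ => S)
    (fun i : Fin (n + 1) => h ⟨i, Finset.mem_Iic.2 (Nat.lt_succ_iff.1 i.2)⟩) y)) ?_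
  have hm : Measurable fun p : ((i : Finset.Iic n) → S) × S =>
      ((fun i : Fin (n + 1) => p.1 ⟨i, Finset.mem_Iic.2 (Nat.lt_succ_iff.1 i.2)⟩, p.2) :
        (Fin (n + 1) → S) × S) :=
    (measurable_pi_lambda _ fun i => (measurable_pi_apply _).comp measurable_fst).prodMk
      measurable_snd
  exact hf.comp ((measurable_finSnoc (n + 1)).comp hm)

/-- The sum of `ℓ` along the transitions of a finite path. -/
def transitionSum (ℓ : S → S → ℝ) (n : ℕ) (x : Fin (n + 1) → S) : ℝ :=
  ∑ i : Fin n, ℓ (x i.castSucc) (x i.succ)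

lemma measurable_transitionSum {ℓ : S → S → ℝ} (hℓ : Measurable (Function.uncurry ℓ)) (n : ℕ) :
    Measurable (transitionSum ℓ n) := by
  unfold transitionSum
  refine Finset.measurable_sum _ fun i _ => ?_
  exact hℓ.comp (by fun_prop : Measurable fun x : Fin (n + 1) → S => (x i.castSucc, x i.succ))

lemma transitionSum_snoc {S : Type*} (ℓ : S → S → ℝ) (n : ℕ) (x : Fin (n + 1) → S) (y : S) :
    transitionSum ℓ (n + 1) (Fin.snoc (α := fun _ => S) x y) =
      transitionSum ℓ n x + ℓ (x (Fin.last n)) y := by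
  unfold transitionSum
  rw [Fin.sum_univ_castSucc]
  congr 1
  · refine Finset.sum_congr rfl fun i _ => ?_
    rw [← Fin.castSucc_succ, Fin.snoc_castSucc, Fin.snoc_castSucc]
  · rw [Fin.snoc_castSucc, Fin.succ_last, Fin.snoc_last]

lemma map_initialSegment_chainLaw_eq_withDensity (κ κ' : Kernel S S) [IsMarkovKernel κ]
    [IsMarkovKernel κ'] (ν : Measure S) [IsProbabilityMeasure ν] {ℓ : S → S → ℝ}
    (hℓ : Measurable (Function.uncurry ℓ))
    (h : ∀ x, κ x = (κ' x).withDensity fun y => ENNReal.ofReal (Real.exp (ℓ x y))) (n : ℕ) :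
    (chainLaw κ ν).map (initialSegment S n) =
      ((chainLaw κ' ν).map (initialSegment S n)).withDensity
        fun x => ENNReal.ofReal (Real.exp (transitionSum ℓ n x)) := by
  have hm : ∀ n, Measurable fun x => ENNReal.ofReal (Real.exp (transitionSum ℓ n x)) :=
    fun n => (measurable_transitionSum hℓ n).exp.ennreal_ofReal
  have key : ∀ (n : ℕ) (f : (Fin (n + 1) → S) → ℝ≥0∞), Measurable f →
      ∫⁻ ω, f (initialSegment S n ω) ∂(chainLaw κ ν) =
        ∫⁻ ω, ENNReal.ofReal (Real.exp (transitionSum ℓ n (initialSegment S n ω))) *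
          f (initialSegment S n ω) ∂(chainLaw κ' ν) := by
    intro n
    induction n with
    | zero =>
      intro f hf
      let g : S → ℝ≥0∞ := fun x => f (fun _ => x)
      have hg : Measurable g := hf.comp (measurable_pi_lambda _ fun _ => measurable_id)
      have e : ∀ ω : ℕ → S, f (initialSegment S 0 ω) = g (ω 0) := fun ω => by
        refine congrArg f (funext fun i => ?_)
        rw [Fin.fin_one_eq_zero i]; rfl
      simp only [e, transitionSum, Finset.univ_eq_empty, Finset.sum_empty, Real.exp_zero,
        ENNReal.ofReal_one, one_mul]
      have e0 : ∀ η : Kernel S S, ∀ [IsMarkovKernel η],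
          ∫⁻ ω, g (ω 0) ∂(chainLaw η ν) = ∫⁻ x, g x ∂ν := fun η _ => by
        conv_rhs => rw [← map_zero_chainLaw η ν]
        rw [lintegral_map hg (by fun_prop)]
      rw [e0, e0]
    | succ n ih =>
      intro f hf
      have hmf : Measurable fun x => ENNReal.ofReal (Real.exp (transitionSum ℓ (n + 1) x)) * f x :=
        (hm (n + 1)).mul hf
      rw [lintegral_initialSegment_succ κ ν n hf, lintegral_initialSegment_succ κ' ν n hmf]
      have hf' : Measurable fun p : (Fin (n + 1) → S) × S =>
        f (Fin.snoc (α := fun _ => S) p.1 p.2) := hf.comp (measurable_finSnoc (n + 1))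
      have hG : Measurable fun x : Fin (n + 1) → S =>
          ∫⁻ y, f (Fin.snoc (α := fun _ => S) x y) ∂(κ (x (Fin.last n))) :=
        hf'.lintegral_kernel_prod_right'
          (κ := κ.comap (fun x : Fin (n + 1) → S => x (Fin.last n)) (by fun_prop))
      refine (ih _ hG).trans (lintegral_congr fun ω => ?_)
      have hℓx : Measurable fun y => ENNReal.ofReal (Real.exp (ℓ (ω n) y)) :=
        (hℓ.comp (measurable_const.prodMk measurable_id)).exp.ennreal_ofReal
      have hfx : Measurable fun y => f (Fin.snoc (α := fun _ => S) (initialSegment S n ω) y) :=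
        hf'.comp (measurable_const.prodMk measurable_id)
      have hlast : initialSegment S n ω (Fin.last n) = ω n := by simp [initialSegment]
      rw [hlast, h, lintegral_withDensity_eq_lintegral_mul _ hℓx hfx,
        ← lintegral_const_mul _ (hℓx.mul hfx)]
      refine lintegral_congr fun y => ?_
      rw [transitionSum_snoc, hlast, Real.exp_add, ENNReal.ofReal_mul (Real.exp_pos _).le,
        Pi.mul_apply, mul_assoc]
  refine Measure.ext_of_lintegral _ fun f hf => ?_
  rw [lintegral_withDensity_eq_lintegral_mul _ (hm n) hf, lintegral_map hf (by fun_prop),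
    lintegral_map ((hm n).mul hf) (by fun_prop)]
  exact key n f hf

end PathDensity

section KullbackLeibler

variable {α : Type*} [MeasurableSpace α]

lemma klDiv_withDensity_exp {μ ν : Measure α} [IsProbabilityMeasure μ] [IsProbabilityMeasure ν]
    {R : α → ℝ} (hR : Measurable R) (h : μ = ν.withDensity fun x => ENNReal.ofReal (Real.exp (R x)))
    (hint : Integrable R μ) :
    InformationTheory.klDiv μ ν = ENNReal.ofReal (∫ x, R x ∂μ) ∧ 0 ≤ ∫ x, R x ∂μ := by
  have hac : μ ≪ ν := h ▸ withDensity_absolutelyContinuous _ _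
  have hrn : μ.rnDeriv ν =ᵐ[ν] fun x => ENNReal.ofReal (Real.exp (R x)) := by
    rw [h]
    exact Measure.rnDeriv_withDensity _ hR.exp.ennreal_ofReal
  have hllr : llr μ ν =ᵐ[μ] R := by
    filter_upwards [hac.ae_le hrn] with x hx
    rw [llr, hx, ENNReal.toReal_ofReal (Real.exp_pos _).le, Real.log_exp]
  have hi : Integrable (llr μ ν) μ := hint.congr hllr.symm
  have h1 := InformationTheory.klDiv_of_ac_of_integrable hac hi
  have h2 := InformationTheory.integral_llr_add_sub_measure_univ_nonneg hac hi
  rw [integral_congr_ae hllr] at h1 h2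
  simp only [probReal_univ, add_sub_cancel_right] at h1 h2
  exact ⟨h1, h2⟩

lemma klDiv_le_log_of_le_smul {μ ν : Measure α} [IsProbabilityMeasure μ] [IsProbabilityMeasure ν]
    {c : ℝ} (hc : 1 ≤ c) (h : μ ≤ ENNReal.ofReal c • ν) :
    InformationTheory.klDiv μ ν ≤ ENNReal.ofReal (Real.log c) := by
  have hac : μ ≪ ν := (Measure.absolutelyContinuous_of_le h).trans
    (Measure.smul_absolutelyContinuous)
  have hrn : μ.rnDeriv ν ≤ᵐ[ν] fun _ => ENNReal.ofReal c := by
    refine ae_le_of_forall_setLIntegral_le_of_sigmaFinite (Measure.measurable_rnDeriv _ _)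
      fun s hs _ => ?_
    refine (Measure.setLIntegral_rnDeriv_le s).trans ?_
    simpa using h s
  have hi : Integrable (fun x => (μ.rnDeriv ν x).toReal) ν := Measure.integrable_toReal_rnDeriv
  have hlog : 0 ≤ Real.log c := Real.log_nonneg hc
  have hbound : ∀ᵐ x ∂ν, InformationTheory.klFun (μ.rnDeriv ν x).toReal ≤
      (μ.rnDeriv ν x).toReal * Real.log c + (1 - (μ.rnDeriv ν x).toReal) := by
    filter_upwards [hrn] with x hx
    have hx' : (μ.rnDeriv ν x).toReal ≤ c := ENNReal.toReal_le_of_le_ofReal (by linarith) hx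
    have h0 : 0 ≤ (μ.rnDeriv ν x).toReal := ENNReal.toReal_nonneg
    rw [InformationTheory.klFun]
    rcases h0.eq_or_lt with h0 | h0
    · simp [← h0]
    · have := mul_le_mul_of_nonneg_left (Real.log_le_log h0 hx') h0.le
      linarith
  have hi2 : Integrable (fun x => (μ.rnDeriv ν x).toReal * Real.log c +
      (1 - (μ.rnDeriv ν x).toReal)) ν :=
    (hi.mul_const _).add ((integrable_const _).sub hi)
  rw [InformationTheory.klDiv_eq_lintegral_klFun_of_ac hac]
  refine (lintegral_mono_ae (hbound.mono fun x hx => ENNReal.ofReal_le_ofReal hx)).trans ?_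
  rw [← ofReal_integral_eq_lintegral_ofReal hi2 (hbound.mono fun x hx =>
      (InformationTheory.klFun_nonneg ENNReal.toReal_nonneg).trans hx),
    integral_add (hi.mul_const _) (by fun_prop), integral_mul_const,
    integral_sub (integrable_const _) hi, Measure.integral_toReal_rnDeriv hac]
  simp

end KullbackLeibler

section Moments

lemma add_rpow_le_two_rpow_mul {a b p : ℝ} (ha : 0 ≤ a) (hb : 0 ≤ b) (hp : 0 ≤ p) :
    (a + b) ^ p ≤ 2 ^ p * (a ^ p + b ^ p) := by
  have h1 : a + b ≤ 2 * max a b := by linarith [le_max_left a b, le_max_right a b]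
  refine (Real.rpow_le_rpow (by positivity) h1 hp).trans ?_
  rw [Real.mul_rpow (by norm_num) (by positivity)]
  refine mul_le_mul_of_nonneg_left ?_ (by positivity)
  rcases max_choice a b with h | h <;> rw [h]
  · exact le_add_of_nonneg_right (by positivity)
  · exact le_add_of_nonneg_left (by positivity)

/-- The absolute moment of order `p` of the standard Gaussian. -/
noncomputable def gaussianAbsMoment (p : ℝ) : ℝ := ∫ z, |z| ^ p ∂(gaussianReal 0 1)

lemma gaussianAbsMoment_nonneg (p : ℝ) : 0 ≤ gaussianAbsMoment p :=
  integral_nonneg fun _ => by positivity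

lemma integrable_abs_rpow_gaussianReal (m : ℝ) (v : ℝ≥0) {p : ℝ} (hp : 0 < p) :
    Integrable (fun z => |z| ^ p) (gaussianReal m v) := by
  have h := (memLp_id_gaussianReal (μ := m) (v := v) p.toNNReal).integrable_norm_rpow'
  simpa [hp.le] using h

lemma lintegral_abs_rpow_gaussianReal_le (m : ℝ) (v : ℝ≥0) {p : ℝ} (hp : 0 < p) :
    ∫⁻ y, ENNReal.ofReal (|y| ^ p) ∂(gaussianReal m v) ≤
      ENNReal.ofReal (2 ^ p * (|m| ^ p + √v ^ p * gaussianAbsMoment p)) := by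
  have h1 : gaussianReal m v = (gaussianReal 0 1).map (fun z => m + √v * z) := by
    have : (fun z => m + √v * z) = (fun z => m + z) ∘ (fun z => √(v : ℝ) * z) := rfl
    rw [this, ← Measure.map_map (by fun_prop) (by fun_prop), gaussianReal_map_const_mul,
      gaussianReal_map_const_add]
    congr 1
    · simp
    · ext; simp
  rw [h1, lintegral_map (by fun_prop) (by fun_prop)]
  have h2 : ∀ z : ℝ, |m + √v * z| ^ p ≤ 2 ^ p * (|m| ^ p + √v ^ p * |z| ^ p) := fun z => by
    refine (Real.rpow_le_rpow (abs_nonneg _) (abs_add_le _ _) hp.le).trans ?_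
    refine (add_rpow_le_two_rpow_mul (abs_nonneg _) (abs_nonneg _) hp.le).trans_eq ?_
    rw [abs_mul, abs_of_nonneg (Real.sqrt_nonneg _), Real.mul_rpow (by positivity) (by positivity)]
  refine (lintegral_mono fun z => ENNReal.ofReal_le_ofReal (h2 z)).trans_eq ?_
  have hi := integrable_abs_rpow_gaussianReal 0 1 hp
  rw [← ofReal_integral_eq_lintegral_ofReal]
  · rw [integral_const_mul, integral_add (integrable_const _) (hi.const_mul _),
      integral_const_mul]
    simp [gaussianAbsMoment]
  · exact ((integrable_const _).add (hi.const_mul _)).const_mul _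
  · exact ae_of_all _ fun z => by positivity

end Moments

section AutoregressiveKernel

instance (θ : ℝ) : IsMarkovKernel (ar1Kernel θ) := isMarkovKernel_ar1Kernel θ

lemma ar1Kernel_apply (θ x : ℝ) : ar1Kernel θ x = gaussianReal (θ * x) 1 := rfl

lemma gaussianReal_bind_ar1Kernel (θ m : ℝ) (v : ℝ≥0) :
    (gaussianReal m v).bind (ar1Kernel θ) = gaussianReal (θ * m) ((θ ^ 2).toNNReal * v + 1) := by
  have h1 : gaussianReal (θ * m) ((θ ^ 2).toNNReal * v) =
      (gaussianReal m v).map (θ * ·) := by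
    rw [gaussianReal_map_const_mul]
    congr 2
    exact Real.toNNReal_of_nonneg (sq_nonneg θ)
  have h2 := gaussianReal_conv_gaussianReal (m₁ := θ * m) (m₂ := 0) (v₁ := (θ ^ 2).toNNReal * v)
    (v₂ := 1)
  rw [add_zero] at h2
  rw [← h2, h1]
  refine Measure.ext_of_lintegral _ fun f hf => ?_
  rw [Measure.lintegral_bind (by fun_prop) hf.aemeasurable, Measure.lintegral_conv hf,
    lintegral_map]
  · refine lintegral_congr fun x => ?_
    rw [ar1Kernel_apply, ← lintegral_map (f := f) (g := fun y => θ * x + y) hf (by fun_prop),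
      gaussianReal_map_const_add, zero_add]
  · exact (hf.comp measurable_add).lintegral_prod_right'
  · fun_prop

/-- The variance of the state of the chain at time `n`, given the initial state. -/
noncomputable def ar1Var (θ : ℝ) (n : ℕ) : ℝ≥0 := ∑ i ∈ Finset.range n, (θ ^ 2).toNNReal ^ i

lemma coe_ar1Var (θ : ℝ) (n : ℕ) : (ar1Var θ n : ℝ) = ∑ i ∈ Finset.range n, (θ ^ 2) ^ i := by
  simp [ar1Var, sq_nonneg]

lemma coe_ar1Var_eq {θ : ℝ} (hθ : |θ| < 1) (n : ℕ) :
    (ar1Var θ n : ℝ) = (1 - (θ ^ 2) ^ n) / (1 - θ ^ 2) := by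
  have : θ ^ 2 < 1 := (sq_lt_one_iff_abs_lt_one θ).2 hθ
  rw [coe_ar1Var, geom_sum_eq this.ne, ← neg_div_neg_eq]
  ring

lemma pow_ar1Kernel_apply (θ : ℝ) (n : ℕ) (x : ℝ) :
    (ar1Kernel θ ^ n) x = gaussianReal (θ ^ n * x) (ar1Var θ n) := by
  induction n with
  | zero =>
    rw [pow_zero]
    change Kernel.id x = _
    simp [ar1Var, Kernel.id_apply]
  | succ n ih =>
    rw [pow_succ']
    change ((ar1Kernel θ) ∘ₖ (ar1Kernel θ ^ n)) x = _
    rw [Kernel.comp_apply, ih, gaussianReal_bind_ar1Kernel]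
    congr 1
    · ring
    · rw [ar1Var, ar1Var, Finset.sum_range_succ', Finset.mul_sum]
      simp [pow_succ']

/-- The variance of the invariant law. -/
noncomputable def ar1InvVar (θ : ℝ) : ℝ≥0 := Real.toNNReal (1 / (1 - θ ^ 2))

lemma coe_ar1InvVar {θ : ℝ} (hθ : |θ| < 1) : (ar1InvVar θ : ℝ) = 1 / (1 - θ ^ 2) := by
  have : θ ^ 2 < 1 := (sq_lt_one_iff_abs_lt_one θ).2 hθ
  exact Real.coe_toNNReal _ (by have := sub_pos.2 this; positivity)

lemma ar1InvVar_pos {θ : ℝ} (hθ : |θ| < 1) : 0 < ar1InvVar θ := by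
  have : θ ^ 2 < 1 := (sq_lt_one_iff_abs_lt_one θ).2 hθ
  exact Real.toNNReal_pos.2 (by have := sub_pos.2 this; positivity)

lemma ar1Var_le {θ : ℝ} (hθ : |θ| < 1) (n : ℕ) : ar1Var θ n ≤ ar1InvVar θ := by
  have : θ ^ 2 < 1 := (sq_lt_one_iff_abs_lt_one θ).2 hθ
  rw [← NNReal.coe_le_coe, coe_ar1Var_eq hθ, coe_ar1InvVar hθ]
  have h2 := sub_pos.2 this
  gcongr
  have : 0 ≤ (θ ^ 2) ^ n := by positivity
  linarith

lemma one_le_ar1Var_succ (θ : ℝ) (n : ℕ) : 1 ≤ ar1Var θ (n + 1) := by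
  rw [ar1Var, Finset.sum_range_succ']
  simp

lemma invariant_ar1Kernel {θ : ℝ} (hθ : |θ| < 1) :
    Kernel.Invariant (ar1Kernel θ) (gaussianReal 0 (ar1InvVar θ)) := by
  unfold Kernel.Invariant
  rw [gaussianReal_bind_ar1Kernel, mul_zero]
  congr 1
  have : θ ^ 2 < 1 := (sq_lt_one_iff_abs_lt_one θ).2 hθ
  have h2 := (sub_pos.2 this).ne'
  rw [← NNReal.coe_inj]
  push_cast
  rw [coe_ar1InvVar hθ, Real.coe_toNNReal _ (sq_nonneg θ)]
  field_simp
  ring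

lemma lintegral_abs_rpow_pow_ar1Kernel_le {θ : ℝ} (hθ : |θ| < 1) {p : ℝ} (hp : 0 < p) (n : ℕ)
    (x : ℝ) :
    ∫⁻ y, ENNReal.ofReal (|y| ^ p) ∂((ar1Kernel θ ^ n) x) ≤
      ENNReal.ofReal (2 ^ p * (1 + √(ar1InvVar θ) ^ p * gaussianAbsMoment p) * (1 + |x| ^ p)) := by
  rw [pow_ar1Kernel_apply]
  refine (lintegral_abs_rpow_gaussianReal_le _ _ hp).trans (ENNReal.ofReal_le_ofReal ?_)
  have h0 := gaussianAbsMoment_nonneg p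
  have h1 : |θ ^ n * x| ^ p ≤ |x| ^ p := by
    refine Real.rpow_le_rpow (abs_nonneg _) ?_ hp.le
    rw [abs_mul, abs_pow]
    exact mul_le_of_le_one_left (abs_nonneg _) (pow_le_one₀ (abs_nonneg _) hθ.le)
  have h2 : √(ar1Var θ n) ^ p ≤ √(ar1InvVar θ) ^ p :=
    Real.rpow_le_rpow (Real.sqrt_nonneg _) (Real.sqrt_le_sqrt (by exact_mod_cast ar1Var_le hθ n))
      hp.le
  have h3 := mul_le_mul_of_nonneg_right h2 h0
  have h4 : 0 ≤ √(ar1InvVar θ) ^ p * gaussianAbsMoment p := by positivity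
  have h5 : 0 ≤ |x| ^ p := by positivity
  rw [mul_assoc]
  refine mul_le_mul_of_nonneg_left ?_ (by positivity)
  nlinarith

end AutoregressiveKernel

section Recurrence

lemma ar1Kernel_pos_of_volume_pos (θ x : ℝ) {A : Set ℝ} (hA : 0 < volume A) :
    0 < ar1Kernel θ x A := by
  rw [pos_iff_ne_zero] at hA ⊢
  exact fun h => hA (gaussianReal_absolutelyContinuous' (θ * x) one_ne_zero h)

lemma pow_succ_ar1Kernel_absolutelyContinuous (θ x : ℝ) (n : ℕ) :
    (ar1Kernel θ ^ (n + 1)) x ≪ volume := by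
  rw [pow_ar1Kernel_apply]
  exact gaussianReal_absolutelyContinuous _
    (lt_of_lt_of_le one_pos (one_le_ar1Var_succ θ n)).ne'

lemma isMaximalIrreducibilityMeasure_volume_ar1Kernel (θ : ℝ) :
    IsMaximalIrreducibilityMeasure (ar1Kernel θ) volume := by
  refine ⟨⟨NeZero.ne _, fun A _ h x => ⟨1, le_rfl, ?_⟩⟩, fun φ hφ => ?_⟩
  · rw [pow_one]
    exact ar1Kernel_pos_of_volume_pos θ x h
  · refine Measure.AbsolutelyContinuous.mk fun A hA h => ?_
    by_contra hne
    obtain ⟨n, hn, hpos⟩ := hφ.2 A hA (pos_iff_ne_zero.2 hne) 0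
    obtain ⟨k, rfl⟩ := Nat.exists_eq_add_of_le' hn
    exact hpos.ne' (pow_succ_ar1Kernel_absolutelyContinuous θ 0 k h)

lemma isAperiodic_ar1Kernel (θ : ℝ) : IsAperiodic (ar1Kernel θ) := by
  refine ⟨volume, isMaximalIrreducibilityMeasure_volume_ar1Kernel θ, ?_⟩
  rintro d hd ⟨D, hDm, hDd, hD1, hDc⟩
  have : Fact (1 < d) := ⟨hd⟩
  have hne : ∃ i, (D i).Nonempty := by
    by_contra! h
    simp [h] at hDc
  have hfull : ∀ i, (D i).Nonempty → volume (D (i + 1))ᶜ = 0 := by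
    rintro i ⟨x, hx⟩
    refine gaussianReal_absolutelyContinuous' (θ * x) one_ne_zero ?_
    exact (prob_compl_eq_zero_iff (μ := gaussianReal (θ * x) 1) (hDm (i + 1))).2 (hD1 i x hx)
  have hnext : ∀ i, volume (D i)ᶜ = 0 → (D i).Nonempty := by
    intro i h
    by_contra! h'
    simp [h'] at h
  obtain ⟨i, hi⟩ := hne
  have h1 := hfull i hi
  have h2 := hfull _ (hnext _ h1)
  have hdis := hDd (i + 1) (i + 1 + 1) (by simp)
  have h3 : volume (D (i + 1)) = 0 := measure_mono_null hdis.subset_compl_right h2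
  have h4 : volume (Set.univ : Set ℝ) = 0 := by
    rw [← Set.union_compl_self (D (i + 1))]
    exact measure_union_null h3 h1
  simp at h4

/-- On bounded sets the kernel charges sets of positive Lebesgue measure uniformly. -/
lemma exists_le_ar1Kernel_real (θ : ℝ) {A : Set ℝ} (hA0 : 0 < volume A)
    (R : ℝ) : ∃ c : ℝ, 0 < c ∧ ∀ x, |x| ≤ R → c ≤ (ar1Kernel θ x).real A := by
  let K := |θ| * R
  let g : ℝ → ℝ := fun y => (√(2 * Real.pi))⁻¹ * Real.exp (-(|y| + K) ^ 2 / 2)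
  have hg : Measurable g := by fun_prop
  have hgpos : ∀ y, 0 < g y := fun y => by positivity
  have hle : ∀ x, |x| ≤ R → ∫⁻ y in A, ENNReal.ofReal (g y) ≤ ar1Kernel θ x A := by
    intro x hx
    rw [ar1Kernel_apply, gaussianReal_apply _ one_ne_zero]
    refine lintegral_mono fun y => ?_
    rw [gaussianPDF, gaussianPDFReal]
    refine ENNReal.ofReal_le_ofReal ?_
    have : |y - θ * x| ≤ |y| + K := by
      refine (abs_sub _ _).trans ?_
      rw [abs_mul]
      have := mul_le_mul_of_nonneg_left hx (abs_nonneg θ)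
      simpa [K] using this
    have h2 : (y - θ * x) ^ 2 ≤ (|y| + K) ^ 2 := by
      rw [← sq_abs (y - θ * x)]
      gcongr
    simp only [NNReal.coe_one, mul_one, g]
    gcongr
  have h0 : ∫⁻ y in A, ENNReal.ofReal (g y) ≠ 0 := by
    rw [Ne, lintegral_eq_zero_iff (by fun_prop)]
    intro h
    have h' : ∀ᵐ y ∂(volume.restrict A), False := by
      filter_upwards [h] with y hy
      exact (ENNReal.ofReal_pos.2 (hgpos y)).ne' hy
    rw [ae_iff] at h'
    simp at h'
    exact hA0.ne' h'
  by_cases hR : ∃ x, |x| ≤ R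
  · obtain ⟨x₀, hx₀⟩ := hR
    have hfin : ∫⁻ y in A, ENNReal.ofReal (g y) ≠ ⊤ :=
      ne_top_of_le_ne_top (measure_ne_top _ _) (hle x₀ hx₀)
    refine ⟨_, ENNReal.toReal_pos h0 hfin, fun x hx => ?_⟩
    exact ENNReal.toReal_mono (measure_ne_top _ _) (hle x hx)
  · push Not at hR
    exact ⟨1, one_pos, fun x hx => absurd hx (not_le.2 (hR x))⟩

lemma ae_frequently_mem_of_frequently_abs_le (θ x : ℝ) {A : Set ℝ} (hA : MeasurableSet A)
    (hA0 : 0 < volume A) (R : ℝ) :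
    ∀ᵐ ω ∂(chainLaw (ar1Kernel θ) (Measure.dirac x)),
      (∃ᶠ n in atTop, |ω n| ≤ R) → ∃ᶠ n in atTop, ω n ∈ A := by
  obtain ⟨c, hc, hcA⟩ := exists_le_ar1Kernel_real θ hA0 R
  have hBC := ae_mem_limsup_atTop_iff (chainLaw (ar1Kernel θ) (Measure.dirac x))
    (ℱ := Filtration.piLE (X := fun _ : ℕ => ℝ)) (s := fun n => (fun ω : ℕ → ℝ => ω n) ⁻¹' A) ?_
  · have hce := ae_all_iff.2 fun n => condExp_chainLaw (ar1Kernel θ) (Measure.dirac x) n hA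
    filter_upwards [hBC, hce] with ω h1 h2 h3
    rw [Nat.frequently_atTop_iff_infinite,
      Set.infinite_iff_tendsto_sum_indicator_atTop hc] at h3
    have h4 : ω ∈ limsup (fun n => (fun ω : ℕ → ℝ => ω n) ⁻¹' A) atTop := by
      rw [h1]
      simp_rw [h2]
      refine tendsto_atTop_mono (fun n => Finset.sum_le_sum fun k _ => ?_) h3
      by_cases hk : k ∈ {n | |ω n| ≤ R}
      · rw [Set.indicator_of_mem hk]
        exact hcA _ hk
      · rw [Set.indicator_of_notMem hk]
        exact measureReal_nonneg
    exact mem_limsup_iff_frequently_mem.1 h4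
  · intro n
    rw [Filtration.piLE_eq_comap_frestrictLe]
    exact ⟨(fun h : (i : Finset.Iic n) → ℝ => h ⟨n, by simp⟩) ⁻¹' A,
      (by fun_prop : Measurable fun h : (i : Finset.Iic n) → ℝ => h ⟨n, Finset.mem_Iic.2 le_rfl⟩) hA, rfl⟩

lemma isHarrisRecurrent_ar1Kernel {θ : ℝ} (hθ : |θ| < 1) : IsHarrisRecurrent (ar1Kernel θ) := by
  refine ⟨volume, isMaximalIrreducibilityMeasure_volume_ar1Kernel θ, fun A hA hA0 x => ?_⟩
  have key := ae_all_iff.2 fun k : ℕ => ae_frequently_mem_of_frequently_abs_le θ x hA hA0 k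
  have hC := fun n => lintegral_abs_rpow_pow_ar1Kernel_le hθ one_pos n x
  set C := 2 ^ (1 : ℝ) * (1 + √(ar1InvVar θ) ^ (1 : ℝ) * gaussianAbsMoment 1) * (1 + |x| ^ (1 : ℝ))
  have hfatou : ∫⁻ ω, liminf (fun n => ENNReal.ofReal (|ω n| ^ (1 : ℝ))) atTop
      ∂(chainLaw (ar1Kernel θ) (Measure.dirac x)) ≤ ENNReal.ofReal C := by
    refine (lintegral_liminf_le fun n => by fun_prop).trans ?_
    refine liminf_le_of_frequently_le' (Frequently.of_forall fun n => ?_)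
    rw [lintegral_apply_chainLaw _ _ n (f := fun y => ENNReal.ofReal (|y| ^ (1 : ℝ)))
      (by fun_prop), lintegral_dirac]
    exact hC n
  have hfin := ae_lt_top (.liminf fun n => by fun_prop) (hfatou.trans_lt ENNReal.ofReal_lt_top).ne
  filter_upwards [key, hfin] with ω h1 h2
  obtain ⟨k, hk⟩ := ENNReal.exists_nat_gt h2.ne
  refine h1 k ((frequently_lt_of_liminf_lt (by isBoundedDefault) hk).mono fun n hn => ?_)
  rw [Real.rpow_one, ← ENNReal.ofReal_natCast,
    ENNReal.ofReal_lt_ofReal_iff_of_nonneg (abs_nonneg _)] at hn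
  exact hn.le

lemma isPositiveHarris_ar1Kernel {θ : ℝ} (hθ : |θ| < 1) : IsPositiveHarris (ar1Kernel θ) :=
  ⟨isHarrisRecurrent_ar1Kernel hθ, _, inferInstance, invariant_ar1Kernel hθ⟩

end Recurrence

section GeometricErgodicity

lemma abs_sub_le_abs_log_sub_mul {p q : ℝ} (hp : 0 < p) (hq : 0 < q) :
    |p - q| ≤ |Real.log p - Real.log q| * (p + q) := by
  wlog h : q ≤ p generalizing p q
  · rw [abs_sub_comm, abs_sub_comm (Real.log p), add_comm]
    exact this hq hp (le_of_not_ge h)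
  have h1 : Real.log q - Real.log p ≤ q / p - 1 := by
    rw [← Real.log_div hq.ne' hp.ne']
    exact Real.log_le_sub_one_of_pos (by positivity)
  have h2 : Real.log q ≤ Real.log p := Real.log_le_log hq h
  rw [abs_of_nonneg (by linarith), abs_of_nonneg (by linarith)]
  have h3 : p * (Real.log q - Real.log p) ≤ q - p := by
    have := mul_le_mul_of_nonneg_left h1 hp.le
    have e : p * (q / p - 1) = q - p := by field_simp
    linarith
  nlinarith

lemma log_gaussianPDFReal (m : ℝ) {v : ℝ≥0} (hv : v ≠ 0) (y : ℝ) :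
    Real.log (gaussianPDFReal m v y) =
      -(Real.log (2 * Real.pi * v) / 2) - (y - m) ^ 2 / (2 * v) := by
  have hv' : (0 : ℝ) < v := by exact_mod_cast pos_iff_ne_zero.2 hv
  rw [gaussianPDFReal, Real.log_mul (by positivity) (by positivity), Real.log_inv,
    Real.log_sqrt (by positivity), Real.log_exp]
  ring

lemma integrable_gaussianReal_iff {m : ℝ} {v : ℝ≥0} (hv : v ≠ 0) {g : ℝ → ℝ} :
    Integrable g (gaussianReal m v) ↔ Integrable fun y => gaussianPDFReal m v y * g y := by
  rw [gaussianReal_of_var_ne_zero _ hv,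
    integrable_withDensity_iff_integrable_smul' (measurable_gaussianPDF m v)
      (ae_of_all _ fun _ => ENNReal.ofReal_lt_top)]
  simp [gaussianPDF, gaussianPDFReal_nonneg]

lemma abs_integral_gaussianReal_sub_le {m₁ m₂ : ℝ} {v₁ v₂ : ℝ≥0} (hv₁ : v₁ ≠ 0) (hv₂ : v₂ ≠ 0)
    {g U : ℝ → ℝ} (hg₁ : Integrable g (gaussianReal m₁ v₁))
    (hg₂ : Integrable g (gaussianReal m₂ v₂)) (hU₁ : Integrable U (gaussianReal m₁ v₁))
    (hU₂ : Integrable U (gaussianReal m₂ v₂))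
    (hgU : ∀ y, |g y| * |Real.log (gaussianPDFReal m₁ v₁ y) - Real.log (gaussianPDFReal m₂ v₂ y)|
      ≤ U y) :
    |(∫ y, g y ∂(gaussianReal m₁ v₁)) - ∫ y, g y ∂(gaussianReal m₂ v₂)| ≤
      (∫ y, U y ∂(gaussianReal m₁ v₁)) + ∫ y, U y ∂(gaussianReal m₂ v₂) := by
  rw [integrable_gaussianReal_iff hv₁] at hg₁ hU₁
  rw [integrable_gaussianReal_iff hv₂] at hg₂ hU₂
  simp only [integral_gaussianReal_eq_integral_smul hv₁, integral_gaussianReal_eq_integral_smul hv₂,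
    smul_eq_mul]
  rw [← integral_sub hg₁ hg₂, ← integral_add hU₁ hU₂]
  refine (abs_integral_le_integral_abs).trans (integral_mono (hg₁.sub hg₂).abs (hU₁.add hU₂) ?_)
  intro y
  have h1 := gaussianPDFReal_pos m₁ v₁ y hv₁
  have h2 := gaussianPDFReal_pos m₂ v₂ y hv₂
  calc |gaussianPDFReal m₁ v₁ y * g y - gaussianPDFReal m₂ v₂ y * g y|
      = |g y| * |gaussianPDFReal m₁ v₁ y - gaussianPDFReal m₂ v₂ y| := by
        rw [← sub_mul, abs_mul, mul_comm]
    _ ≤ |g y| * (|Real.log (gaussianPDFReal m₁ v₁ y) - Real.log (gaussianPDFReal m₂ v₂ y)| *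
          (gaussianPDFReal m₁ v₁ y + gaussianPDFReal m₂ v₂ y)) := by
        gcongr
        exact abs_sub_le_abs_log_sub_mul h1 h2
    _ ≤ U y * (gaussianPDFReal m₁ v₁ y + gaussianPDFReal m₂ v₂ y) := by
        rw [← mul_assoc]
        exact mul_le_mul_of_nonneg_right (hgU y) (by positivity)
    _ = _ := by ring

/-- Comparison of two Gaussian log-densities with variances `u = v * (1 - τ ^ 2)` and `v`. -/
lemma abs_gaussian_log_density_sub_le {u v τ m x y : ℝ} (h1 : 1 ≤ u) (hvpos : 0 < v)
    (hτ0 : 0 ≤ τ) (hτ1 : τ ≤ 1) (huv : u = v * (1 - τ ^ 2)) (hm : |m| = τ * |x|) :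
    |-(Real.log (2 * Real.pi * u) / 2) - (y - m) ^ 2 / (2 * u) -
      (-(Real.log (2 * Real.pi * v) / 2) - (y - 0) ^ 2 / (2 * v))| ≤
      τ * (v + x ^ 2 + 1) * (1 + y ^ 2) := by
  have hupos : 0 < u := by linarith
  have hlog1 : Real.log (2 * Real.pi * v) - Real.log (2 * Real.pi * u) ≤ v * τ ^ 2 := by
    rw [← Real.log_div (by positivity) (by positivity)]
    refine (Real.log_le_sub_one_of_pos (by positivity)).trans ?_
    have e : 2 * Real.pi * v / (2 * Real.pi * u) - 1 = v * τ ^ 2 / u := by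
      have := Real.pi_pos.ne'
      field_simp
      rw [huv]; ring
    rw [e]
    exact div_le_self (by positivity) h1
  have hlog0 : Real.log (2 * Real.pi * u) ≤ Real.log (2 * Real.pi * v) := by
    refine Real.log_le_log (by positivity) ?_
    have : u ≤ v := by rw [huv]; nlinarith [sq_nonneg τ]
    gcongr
  have e1 : y ^ 2 / (2 * v) = y ^ 2 / (2 * u) - τ ^ 2 * y ^ 2 / (2 * u) := by
    have h1t : 1 - τ ^ 2 ≠ 0 := fun h => by rw [h, mul_zero] at huv; linarith
    rw [huv]
    field_simp
  have e2 : -(y - m) ^ 2 / (2 * u) + y ^ 2 / (2 * v) =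
      (2 * y * m - m ^ 2 - τ ^ 2 * y ^ 2) / (2 * u) := by
    rw [e1]
    field_simp
    ring
  have hτ2 : τ ^ 2 ≤ τ := by nlinarith
  have e3 : |(2 * y * m - m ^ 2 - τ ^ 2 * y ^ 2) / (2 * u)| ≤ τ * (x ^ 2 + y ^ 2) := by
    rw [abs_div, abs_of_pos (by positivity : 0 < 2 * u), div_le_iff₀ (by positivity)]
    have a1 : |2 * y * m| ≤ τ * (x ^ 2 + y ^ 2) := by
      rw [abs_mul, abs_mul, hm, abs_of_pos (two_pos : (0 : ℝ) < 2)]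
      have := two_mul_le_add_sq |y| |x|
      rw [sq_abs, sq_abs] at this
      nlinarith
    have a2 : m ^ 2 ≤ τ * x ^ 2 := by
      rw [← sq_abs, hm, mul_pow, sq_abs]
      gcongr
    have a3 : τ ^ 2 * y ^ 2 ≤ τ * y ^ 2 := by gcongr
    have a4 : 0 ≤ τ * (x ^ 2 + y ^ 2) := by positivity
    have a5 : |2 * y * m - m ^ 2 - τ ^ 2 * y ^ 2| ≤ 2 * (τ * (x ^ 2 + y ^ 2)) := by
      have b1 := abs_le.1 a1
      have b2 : 0 ≤ m ^ 2 := sq_nonneg m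
      have b3 : 0 ≤ τ ^ 2 * y ^ 2 := by positivity
      rw [abs_le]
      constructor <;> nlinarith
    refine a5.trans ?_
    nlinarith
  have e4 : -(Real.log (2 * Real.pi * u) / 2) - (y - m) ^ 2 / (2 * u) -
      (-(Real.log (2 * Real.pi * v) / 2) - (y - 0) ^ 2 / (2 * v)) =
      (Real.log (2 * Real.pi * v) - Real.log (2 * Real.pi * u)) / 2 +
        (2 * y * m - m ^ 2 - τ ^ 2 * y ^ 2) / (2 * u) := by
    rw [← e2]; ring
  rw [e4]
  refine (abs_add_le _ _).trans ?_
  rw [abs_of_nonneg (by linarith : 0 ≤ (Real.log (2 * Real.pi * v) - Real.log (2 * Real.pi * u)) / 2)]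
  have f1 : v * τ ^ 2 ≤ v * τ := by gcongr
  have f2 : 0 ≤ τ * v := by positivity
  have f3 : 0 ≤ τ * (v * y ^ 2 + x ^ 2 * y ^ 2 + 1) := by positivity
  nlinarith

lemma abs_log_gaussianPDFReal_sub_le {θ : ℝ} (hθ : |θ| < 1) (n : ℕ) (x y : ℝ) :
    |Real.log (gaussianPDFReal (θ ^ (n + 1) * x) (ar1Var θ (n + 1)) y) -
      Real.log (gaussianPDFReal 0 (ar1InvVar θ) y)| ≤
      |θ| ^ (n + 1) * (ar1InvVar θ + x ^ 2 + 1) * (1 + y ^ 2) := by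
  have hv₁ : ar1Var θ (n + 1) ≠ 0 := (lt_of_lt_of_le one_pos (one_le_ar1Var_succ θ n)).ne'
  rw [log_gaussianPDFReal _ hv₁, log_gaussianPDFReal _ (ar1InvVar_pos hθ).ne']
  refine abs_gaussian_log_density_sub_le (by exact_mod_cast one_le_ar1Var_succ θ n)
    (by exact_mod_cast ar1InvVar_pos hθ) (by positivity) (pow_le_one₀ (abs_nonneg _) hθ.le) ?_
    (by rw [abs_mul, abs_pow])
  rw [coe_ar1Var_eq hθ, coe_ar1InvVar hθ, ← sq_abs θ, ← pow_mul, ← pow_mul, mul_comm 2]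
  ring

lemma isVGeometricallyErgodic_ar1Kernel {θ : ℝ} (hθ : |θ| < 1) {s C : ℝ} (hs : 0 < s)
    (hC : 0 ≤ C) :
    IsVGeometricallyErgodic (ar1Kernel θ) (gaussianReal 0 (ar1InvVar θ))
      fun x => C * (1 + |x| ^ s) := by
  refine ⟨isPositiveHarris_ar1Kernel hθ, inferInstance, invariant_ar1Kernel hθ,
    2 / (1 + |θ|), (one_lt_div (by positivity)).2 (by linarith), fun x => ?_⟩
  have hp : 0 < s + 2 := by linarith
  set r := 2 / (1 + |θ|)
  set D : ℝ := ar1InvVar θ + x ^ 2 + 1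
  have hD : 0 ≤ D := by positivity
  set I₁ : ℝ := 2 ^ (s + 2) * (1 + √(ar1InvVar θ) ^ (s + 2) * gaussianAbsMoment (s + 2)) *
    (1 + |x| ^ (s + 2))
  set I₂ : ℝ := ∫ y, |y| ^ (s + 2) ∂(gaussianReal 0 (ar1InvVar θ))
  set B : ℝ := D * (4 * C) * ((1 + I₁) + (1 + I₂))
  have key : ∀ n : ℕ, fDist (fun x => C * (1 + |x| ^ s)) ((ar1Kernel θ ^ (n + 1)) x)
      (gaussianReal 0 (ar1InvVar θ)) ≤ ENNReal.ofReal (|θ| ^ (n + 1) * B) := by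
    intro n
    have hI₁ : ∫ y, |y| ^ (s + 2) ∂((ar1Kernel θ ^ (n + 1)) x) ≤ I₁ := by
      rw [integral_eq_lintegral_of_nonneg_ae (ae_of_all _ fun _ => by positivity)
        (by fun_prop : Measurable _).aestronglyMeasurable]
      refine ENNReal.toReal_le_of_le_ofReal ?_ (lintegral_abs_rpow_pow_ar1Kernel_le hθ hp (n + 1) x)
      have := gaussianAbsMoment_nonneg (s + 2)
      positivity
    rw [pow_ar1Kernel_apply] at hI₁ ⊢
    set m := θ ^ (n + 1) * x
    have hv₁ : ar1Var θ (n + 1) ≠ 0 := (lt_of_lt_of_le one_pos (one_le_ar1Var_succ θ n)).ne'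
    have hv₂ := (ar1InvVar_pos hθ).ne'
    refine iSup_le fun g => iSup_le fun hg => iSup_le fun hgV => ?_
    have hgi : ∀ (m : ℝ) (v : ℝ≥0), Integrable g (gaussianReal m v) := fun m v =>
      (((integrable_const _).add (integrable_abs_rpow_gaussianReal m v hs)).const_mul C).mono'
        hg.aestronglyMeasurable (ae_of_all _ fun y => (hgV y).le)
    let U : ℝ → ℝ := fun y => |θ| ^ (n + 1) * D * (4 * C) * (1 + |y| ^ (s + 2))
    have hUi : ∀ (m : ℝ) (v : ℝ≥0), Integrable U (gaussianReal m v) := fun m v =>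
      ((integrable_const _).add (integrable_abs_rpow_gaussianReal m v hp)).const_mul _
    have hUe : ∀ (m : ℝ) (v : ℝ≥0), ∫ y, U y ∂(gaussianReal m v) =
        |θ| ^ (n + 1) * D * (4 * C) * (1 + ∫ y, |y| ^ (s + 2) ∂(gaussianReal m v)) := by
      intro m v
      rw [integral_const_mul, integral_add (integrable_const _)
        (integrable_abs_rpow_gaussianReal m v hp)]
      simp
    rw [if_pos ⟨hgi _ _, hgi _ _⟩]
    refine ENNReal.ofReal_le_ofReal ?_
    refine (abs_integral_gaussianReal_sub_le hv₁ hv₂ (hgi _ _) (hgi _ _) (hUi _ _) (hUi _ _)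
      fun y => ?_).trans ?_
    · have h1 := abs_log_gaussianPDFReal_sub_le hθ n x y
      have h2 : (1 + |y| ^ s) * (1 + y ^ 2) ≤ 4 * (1 + |y| ^ (s + 2)) := by
        have e : |y| ^ (s + 2) = |y| ^ s * y ^ 2 := by
          rw [Real.rpow_add_of_nonneg (abs_nonneg _) hs.le (by norm_num)]
          simp
        rcases le_total |y| 1 with hy | hy
        · have a1 : |y| ^ s ≤ 1 := Real.rpow_le_one (abs_nonneg _) hy hs.le
          have a2 : y ^ 2 ≤ 1 := (sq_le_one_iff_abs_le_one y).2 hy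
          have a3 : 0 ≤ |y| ^ s := by positivity
          have a4 : 0 ≤ |y| ^ (s + 2) := by positivity
          nlinarith [sq_nonneg y]
        · have a1 : 1 ≤ |y| ^ s := Real.one_le_rpow hy hs.le
          have a2 : 1 ≤ y ^ 2 := (one_le_sq_iff_one_le_abs y).2 hy
          rw [e]
          nlinarith
      calc _ ≤ (C * (1 + |y| ^ s)) * (|θ| ^ (n + 1) * D * (1 + y ^ 2)) := by
            gcongr
            · exact (hgV y).le
        _ = |θ| ^ (n + 1) * D * C * ((1 + |y| ^ s) * (1 + y ^ 2)) := by ring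
        _ ≤ |θ| ^ (n + 1) * D * C * (4 * (1 + |y| ^ (s + 2))) := by gcongr
        _ = U y := by simp only [U]; ring
    · rw [hUe, hUe, ← mul_add, show |θ| ^ (n + 1) * B = |θ| ^ (n + 1) * D * (4 * C) *
        ((1 + I₁) + (1 + I₂)) by simp only [B]; ring]
      gcongr
  have hr0 : 0 ≤ r := by positivity
  have hrθ : r * |θ| < 1 := by
    rw [div_mul_eq_mul_div, div_lt_one (by positivity)]
    linarith
  have hsum : Summable fun n : ℕ => (r * |θ|) ^ (n + 1) * B :=
    ((summable_nat_add_iff 1).2 (summable_geometric_of_lt_one (by positivity) hrθ)).mul_right B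
  refine lt_of_le_of_lt (ENNReal.tsum_le_tsum fun n => ?_) hsum.tsum_ofReal_lt_top
  refine (mul_le_mul_right (key n) _).trans_eq ?_
  rw [← ENNReal.ofReal_mul (by positivity), mul_pow, mul_assoc]

end GeometricErgodicity

section Generation

variable {Ω : Type*} [MeasurableSpace Ω] {P : Measure Ω} [IsProbabilityMeasure P]

lemma indepFun_prodMk_left {α β γ : Type*} [MeasurableSpace α] [MeasurableSpace β]
    [MeasurableSpace γ] {f : Ω → α} {g : Ω → β} {h : Ω → γ} (hf : AEMeasurable f P)
    (hg : AEMeasurable g P) (hh : AEMeasurable h P)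
    (h₁ : IndepFun f (fun ω => (g ω, h ω)) P) (h₂ : IndepFun g h P) :
    IndepFun (fun ω => (f ω, g ω)) h P := by
  have h₃ : IndepFun f g P := h₁.comp measurable_id measurable_fst
  rw [indepFun_iff_map_prod_eq_prod_map_map (by fun_prop) (by fun_prop)] at *
  rw [h₃]
  refine MeasurableEquiv.prodAssoc.map_measurableEquiv_injective ?_
  rw [Measure.prodAssoc_prod, ← h₂, ← h₁,
    AEMeasurable.map_map_of_aemeasurable (by fun_prop) (by fun_prop)]
  rfl

lemma indepFun_restrict_of_linear_recursion {θ : ℝ} {X W : ℕ → Ω → ℝ}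
    (hW : ∀ n, AEMeasurable (W n) P) (hX0 : AEMeasurable (X 0) P) (hW_indep : iIndepFun W P)
    (hX_W : IndepFun (X 0) (fun ω n => W n ω) P)
    (hX : ∀ n ω, X (n + 1) ω = θ * X n ω + W n ω) (n : ℕ) :
    IndepFun (fun ω (i : Finset.Iic n) => X i ω) (W n) P := by
  have h1 : IndepFun (fun ω (j : Finset.range n) => W j ω)
      (fun ω (j : ({n} : Finset ℕ)) => W j ω) P :=
    hW_indep.indepFun_finset₀ _ _ (by simp) hW
  have h2 : IndepFun (fun ω (j : Finset.range n) => W j ω) (W n) P :=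
    h1.comp measurable_id
      (by fun_prop : Measurable fun h : ({n} : Finset ℕ) → ℝ => h ⟨n, Finset.mem_singleton_self n⟩)
  have h3 : IndepFun (X 0) (fun ω => ((fun (j : Finset.range n) => W j ω), W n ω)) P :=
    hX_W.comp measurable_id
      (by fun_prop : Measurable fun w : ℕ → ℝ => ((fun (j : Finset.range n) => w j), w n))
  have h4 := indepFun_prodMk_left hX0
    (aemeasurable_pi_lambda (fun ω (j : Finset.range n) => W j ω) fun j => hW j) (hW n) h3 h2
  rw [IndepFun_iff_Indep] at h4 ⊢
  refine indep_of_indep_of_le_left h4 ?_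
  set m := MeasurableSpace.comap (fun ω => (X 0 ω, fun (j : Finset.range n) => W j ω)) inferInstance
  have hpair : Measurable[m] fun ω => (X 0 ω, fun (j : Finset.range n) => W j ω) :=
    comap_measurable _
  have hXi : ∀ i, i ≤ n → Measurable[m] (X i) := by
    intro i
    induction i with
    | zero => exact fun _ => measurable_fst.comp hpair
    | succ i ih =>
      intro hi
      have hWi : Measurable[m] (W i) :=
        (measurable_pi_apply (⟨i, Finset.mem_range.2 hi⟩ : Finset.range n)).comp
          (measurable_snd.comp hpair)
      have : X (i + 1) = fun ω => θ * X i ω + W i ω := funext (hX i)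
      rw [this]
      exact ((ih (by omega)).const_mul θ).add hWi
  exact (measurable_pi_lambda (fun ω (i : Finset.Iic n) => X i ω)
    fun i => hXi i (Finset.mem_Iic.1 i.2)).comap_le

lemma hasLaw_chainLaw_of_linear_recursion {θ : ℝ} {X W : ℕ → Ω → ℝ} {ν : Measure ℝ}
    [IsProbabilityMeasure ν]
    (hW : ∀ n, HasLaw (W n) (gaussianReal 0 1) P) (hX0 : HasLaw (X 0) ν P)
    (hW_indep : iIndepFun W P) (hX_W : IndepFun (X 0) (fun ω n => W n ω) P)
    (hX : ∀ n ω, X (n + 1) ω = θ * X n ω + W n ω) :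
    HasLaw (fun ω n => X n ω) (chainLaw (ar1Kernel θ) ν) P := by
  have hXm : ∀ n, AEMeasurable (X n) P := by
    intro n
    induction n with
    | zero => exact hX0.aemeasurable
    | succ n ih =>
      have : X (n + 1) = fun ω => θ * X n ω + W n ω := funext (hX n)
      rw [this]
      exact (ih.const_mul θ).add (hW n).aemeasurable
  have hXa : AEMeasurable (fun ω n => X n ω) P := aemeasurable_pi_lambda _ hXm
  refine ⟨hXa, ?_⟩
  have := Measure.isProbabilityMeasure_map hXa
  refine eq_chainLaw_of_lintegral_succ _ ?_ fun n F hF => ?_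
  · rw [AEMeasurable.map_map_of_aemeasurable (measurable_pi_apply 0).aemeasurable hXa]
    exact hX0.map_eq
  · have hind := indepFun_restrict_of_linear_recursion (fun n => (hW n).aemeasurable)
      hX0.aemeasurable hW_indep hX_W hX n
    have hXn : AEMeasurable (fun ω (i : Finset.Iic n) => X i ω) P :=
      aemeasurable_pi_lambda _ fun i => hXm i
    rw [indepFun_iff_map_prod_eq_prod_map_map hXn (hW n).aemeasurable, (hW n).map_eq] at hind
    have hm1 : Measurable fun ω : ℕ → ℝ => F (Preorder.frestrictLe n ω) (ω (n + 1)) :=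
      hF.comp (by fun_prop : Measurable fun ω : ℕ → ℝ => (Preorder.frestrictLe n ω, ω (n + 1)))
    let last : ((i : Finset.Iic n) → ℝ) → ℝ := fun h => h ⟨n, by simp⟩
    have hlast : Measurable last := by fun_prop
    let G : ((i : Finset.Iic n) → ℝ) → ℝ≥0∞ := fun h => ∫⁻ y, F h y ∂(ar1Kernel θ (last h))
    have hG : Measurable G :=
      hF.lintegral_kernel_prod_right' (κ := (ar1Kernel θ).comap last hlast)
    have hm2 : Measurable fun ω : ℕ → ℝ => G (Preorder.frestrictLe n ω) :=
      hG.comp (Preorder.measurable_frestrictLe (X := fun _ : ℕ => ℝ) n)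
    have hF' : Measurable fun p : ((i : Finset.Iic n) → ℝ) × ℝ => F p.1 (θ * last p.1 + p.2) :=
      hF.comp (by fun_prop : Measurable fun p : ((i : Finset.Iic n) → ℝ) × ℝ =>
        (p.1, θ * last p.1 + p.2))
    rw [lintegral_map' hm1.aemeasurable hXa]
    refine Eq.trans ?_ (lintegral_map' hm2.aemeasurable hXa).symm
    have e1 := lintegral_map' (μ := P) (f := fun p : ((i : Finset.Iic n) → ℝ) × ℝ =>
      F p.1 (θ * last p.1 + p.2)) hF'.aemeasurable (hXn.prodMk (hW n).aemeasurable)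
    rw [hind, lintegral_prod _ hF'.aemeasurable] at e1
    have e2 : ∀ h : (i : Finset.Iic n) → ℝ,
        ∫⁻ w, F h (θ * last h + w) ∂(gaussianReal 0 1) = G h := fun h => by
      have hFh : Measurable (F h) := hF.comp (measurable_const.prodMk measurable_id)
      simp only [G]
      rw [ar1Kernel_apply, ← lintegral_map (f := F h) (g := fun w => θ * last h + w)
        hFh (by fun_prop), gaussianReal_map_const_add, zero_add]
    simp only [e2] at e1
    rw [lintegral_map' hG.aemeasurable hXn] at e1
    refine Eq.trans (lintegral_congr fun ω => ?_) e1.symm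
    exact congrArg _ (hX n ω)

end Generation

section BetaDistribution

open Real in
lemma beta_add_one_left {α β : ℝ} (hα : 0 < α) (hβ : 0 < β) :
    beta (α + 1) β = α / (α + β) * beta α β := by
  have h := (Gamma_pos_of_pos (add_pos hα hβ)).ne'
  have h' := (add_pos hα hβ).ne'
  rw [beta, beta, Gamma_add_one hα.ne', show α + 1 + β = (α + β) + 1 by ring, Gamma_add_one h']
  field_simp

lemma beta_comm (α β : ℝ) : beta α β = beta β α := by
  rw [beta, beta, mul_comm, add_comm]

lemma beta_add_one_right {α β : ℝ} (hα : 0 < α) (hβ : 0 < β) :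
    beta α (β + 1) = β / (α + β) * beta α β := by
  rw [beta_comm, beta_add_one_left hβ hα, beta_comm β, add_comm]

lemma betaPDFReal_nonneg {α β : ℝ} (hα : 0 < α) (hβ : 0 < β) (x : ℝ) :
    0 ≤ betaPDFReal α β x := by
  by_cases h : 0 < x ∧ x < 1
  · exact (betaPDFReal_pos h.1 h.2 hα hβ).le
  · rw [betaPDFReal, if_neg h]

lemma integrable_betaPDFReal {α β : ℝ} (hα : 0 < α) (hβ : 0 < β) :
    Integrable (betaPDFReal α β) := by
  refine ⟨(measurable_betaPDFReal α β).aestronglyMeasurable, ?_⟩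
  rw [hasFiniteIntegral_iff_ofReal (ae_of_all _ (betaPDFReal_nonneg hα hβ))]
  exact (lintegral_betaPDF_eq_one hα hβ).trans_lt ENNReal.one_lt_top

lemma integral_betaPDFReal {α β : ℝ} (hα : 0 < α) (hβ : 0 < β) :
    ∫ x, betaPDFReal α β x = 1 := by
  rw [integral_eq_lintegral_of_nonneg_ae (ae_of_all _ (betaPDFReal_nonneg hα hβ))
    (measurable_betaPDFReal α β).aestronglyMeasurable]
  exact congrArg ENNReal.toReal (lintegral_betaPDF_eq_one hα hβ)

lemma measurable_betaPDF (α β : ℝ) : Measurable (betaPDF α β) :=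
  (measurable_betaPDFReal α β).ennreal_ofReal

lemma integrable_betaMeasure_iff {α β : ℝ} (hα : 0 < α) (hβ : 0 < β) {g : ℝ → ℝ} :
    Integrable g (betaMeasure α β) ↔ Integrable fun x => betaPDFReal α β x * g x := by
  have h : (fun x => (betaPDF α β x).toReal • g x) = fun x => betaPDFReal α β x * g x :=
    funext fun x => by
      rw [betaPDF, ENNReal.toReal_ofReal (betaPDFReal_nonneg hα hβ x), smul_eq_mul]
  rw [betaMeasure, integrable_withDensity_iff_integrable_smul'
      (measurable_betaPDF α β) (ae_of_all _ fun _ => ENNReal.ofReal_lt_top), h]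

lemma integral_betaMeasure {α β : ℝ} (hα : 0 < α) (hβ : 0 < β) (g : ℝ → ℝ) :
    ∫ x, g x ∂(betaMeasure α β) = ∫ x, betaPDFReal α β x * g x := by
  rw [betaMeasure, integral_withDensity_eq_integral_toReal_smul
      (measurable_betaPDF α β) (ae_of_all _ fun _ => ENNReal.ofReal_lt_top)]
  refine integral_congr_ae (ae_of_all _ fun x => ?_)
  simp only
  rw [betaPDF, ENNReal.toReal_ofReal (betaPDFReal_nonneg hα hβ x), smul_eq_mul]

lemma ae_mem_Ioo_betaMeasure (α β : ℝ) : ∀ᵐ x ∂(betaMeasure α β), x ∈ Set.Ioo (0 : ℝ) 1 := by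
  rw [betaMeasure, ae_withDensity_iff (measurable_betaPDF α β)]
  refine ae_of_all _ fun x h => ?_
  by_contra hx
  exact h (by rw [betaPDF, betaPDFReal, if_neg (show ¬(0 < x ∧ x < 1) from hx), ENNReal.ofReal_zero])

/-- The Beta distribution with mode `x₀` and concentration `N`. -/
noncomputable def modeBeta (N x₀ : ℝ) : Measure ℝ := betaMeasure (N * x₀ + 1) (N * (1 - x₀) + 1)

variable {N x₀ : ℝ}

lemma modeBeta_weighted_variance (hN : 0 < N) (hx₀ : x₀ ∈ Set.Ioo (0 : ℝ) 1) :
    Integrable (fun x => (x - x₀) ^ 2 / (x * (1 - x))) (modeBeta N x₀) ∧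
      ∫ x, (x - x₀) ^ 2 / (x * (1 - x)) ∂(modeBeta N x₀) = 1 / N := by
  have h1 : 0 < 1 - x₀ := sub_pos.2 hx₀.2
  have h0 : 0 < x₀ := hx₀.1
  set α := N * x₀ with hα'
  set β := N * (1 - x₀) with hβ'
  have hα : 0 < α := by positivity
  have hβ : 0 < β := by positivity
  have hαβ : α + β = N := by rw [hα', hβ']; ring
  have hB := beta_pos hα hβ
  have e1 : beta (α + 1) β = x₀ * beta α β := by
    rw [beta_add_one_left hα hβ, hαβ, hα']; field_simp
  have e2 : beta (α + 2) β = (N * x₀ + 1) / (N + 1) * (x₀ * beta α β) := by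
    rw [show α + 2 = (α + 1) + 1 by ring, beta_add_one_left (by positivity) hβ, e1,
      show α + 1 + β = N + 1 by linarith]
  have e3 : beta (α + 1) (β + 1) = N * (1 - x₀) / (N + 1) * (x₀ * beta α β) := by
    rw [beta_add_one_right (by positivity) hβ, e1, show α + 1 + β = N + 1 by linarith]
  have hB3 := beta_pos (α := α + 1) (β := β + 1) (by positivity) (by positivity)
  set b := beta α β
  set c := beta (α + 1) (β + 1)
  have key : (fun x => betaPDFReal (α + 1) (β + 1) x * ((x - x₀) ^ 2 / (x * (1 - x)))) =
      fun x => beta (α + 2) β / c * betaPDFReal (α + 2) β x -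
        2 * x₀ * (beta (α + 1) β / c) * betaPDFReal (α + 1) β x +
        x₀ ^ 2 * (b / c) * betaPDFReal α β x := by
    funext x
    unfold betaPDFReal
    split_ifs with hx
    · have hx1 : 0 < 1 - x := sub_pos.2 hx.2
      have hb2 := (beta_pos (α := α + 2) (β := β) (by positivity) hβ).ne'
      have hb1 := (beta_pos (α := α + 1) (β := β) (by positivity) hβ).ne'
      have p1 : x ^ (α + 1 - 1) = x ^ (α - 1) * x := by
        rw [show α + 1 - 1 = (α - 1) + 1 by ring, Real.rpow_add_one hx.1.ne']
      have p2 : x ^ (α + 2 - 1) = x ^ (α - 1) * x * x := by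
        rw [show α + 2 - 1 = (α - 1) + 1 + 1 by ring, Real.rpow_add_one hx.1.ne',
          Real.rpow_add_one hx.1.ne']
      have p3 : (1 - x) ^ (β + 1 - 1) = (1 - x) ^ (β - 1) * (1 - x) := by
        rw [show β + 1 - 1 = (β - 1) + 1 by ring, Real.rpow_add_one hx1.ne']
      rw [p1, p2, p3]
      have := hx.1.ne'
      change 1 / c * _ * _ * _ = _ - _ + _ * (1 / b * _ * _)
      generalize x ^ (α - 1) = p
      generalize (1 - x) ^ (β - 1) = q
      field_simp
      ring
    · simp
  have i2 := integrable_betaPDFReal (α := α + 2) (β := β) (by positivity) hβ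
  have i1 := integrable_betaPDFReal (α := α + 1) (β := β) (by positivity) hβ
  have i0 := integrable_betaPDFReal hα hβ
  have hα1 : 0 < α + 1 := by positivity
  have hβ1 : 0 < β + 1 := by positivity
  rw [modeBeta, ← hα', ← hβ', integrable_betaMeasure_iff hα1 hβ1, integral_betaMeasure hα1 hβ1, key]
  have j2 := i2.const_mul (beta (α + 2) β / c)
  have j1 := i1.const_mul (2 * x₀ * (beta (α + 1) β / c))
  have j0 := i0.const_mul (x₀ ^ 2 * (b / c))
  refine ⟨(j2.sub j1).add j0, ?_⟩
  rw [integral_add (by exact j2.sub j1) j0, integral_sub j2 j1, integral_const_mul, integral_const_mul,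
    integral_const_mul, integral_betaPDFReal (by positivity) hβ,
    integral_betaPDFReal (by positivity) hβ, integral_betaPDFReal hα hβ, e1, e2, e3]
  field_simp
  ring

lemma beta_kernel_le_mode (hN : 0 < N) (hx₀ : x₀ ∈ Set.Ioo (0 : ℝ) 1) {x : ℝ}
    (hx : x ∈ Set.Ioo (0 : ℝ) 1) :
    x ^ (N * x₀) * (1 - x) ^ (N * (1 - x₀)) ≤ x₀ ^ (N * x₀) * (1 - x₀) ^ (N * (1 - x₀)) := by
  have h1 : 0 < 1 - x₀ := sub_pos.2 hx₀.2
  have h0 : 0 < x₀ := hx₀.1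
  have hx1 : 0 < 1 - x := sub_pos.2 hx.2
  have hx0 : 0 < x := hx.1
  have h := Real.geom_mean_le_arith_mean2_weighted h0.le h1.le (div_pos hx0 h0).le
    (div_pos hx1 h1).le (by ring)
  have e : x₀ * (x / x₀) + (1 - x₀) * ((1 - x) / (1 - x₀)) = 1 := by
    field_simp
    ring
  rw [e, Real.div_rpow hx0.le h0.le, Real.div_rpow hx1.le h1.le, div_mul_div_comm,
    div_le_one (by positivity)] at h
  have h2 := Real.rpow_le_rpow (by positivity) h hN.le
  rwa [Real.mul_rpow (by positivity) (by positivity), Real.mul_rpow (by positivity) (by positivity),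
    ← Real.rpow_mul hx0.le, ← Real.rpow_mul hx1.le, ← Real.rpow_mul h0.le, ← Real.rpow_mul h1.le,
    mul_comm x₀, mul_comm (1 - x₀)] at h2

lemma beta_mode_le (hN : 0 < N) (hx₀ : x₀ ∈ Set.Ioo (0 : ℝ) 1) :
    x₀ ^ (N * x₀) * (1 - x₀) ^ (N * (1 - x₀)) ≤
      Real.exp 1 * (N + 1) / (1 - x₀) * beta (N * x₀ + 1) (N * (1 - x₀) + 1) := by
  have h1 : 0 < 1 - x₀ := sub_pos.2 hx₀.2
  have h0 : 0 < x₀ := hx₀.1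
  set c := beta (N * x₀ + 1) (N * (1 - x₀) + 1)
  have hα1 : 0 < N * x₀ + 1 := by positivity
  have hβ1 : 0 < N * (1 - x₀) + 1 := by positivity
  have hc : 0 < c := beta_pos hα1 hβ1
  set h := (1 - x₀) / (N + 1) with hh
  have hhpos : 0 < h := by positivity
  set g := x₀ ^ (N * x₀) * (1 - x₀) ^ (N * (1 - x₀))
  have hlow : ∀ x ∈ Set.Ioo x₀ (x₀ + h),
      1 / c * (g * Real.exp (-1)) ≤ betaPDFReal (N * x₀ + 1) (N * (1 - x₀) + 1) x := by
    intro x hx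
    have hxlow : (1 - x₀) * (N / (N + 1)) ≤ 1 - x := by
      have : (1 - x₀) * (N / (N + 1)) = 1 - x₀ - h := by rw [hh]; field_simp; ring
      linarith [hx.2]
    have hx1 : 0 < 1 - x := lt_of_lt_of_le (by positivity) hxlow
    have hx0 : 0 < x := h0.trans hx.1
    rw [betaPDFReal, if_pos ⟨hx0, by linarith⟩,
      mul_assoc (1 / beta (N * x₀ + 1) (N * (1 - x₀) + 1))]
    refine mul_le_mul_of_nonneg_left ?_ (one_div_nonneg.2 hc.le)
    rw [show N * x₀ + 1 - 1 = N * x₀ by ring, show N * (1 - x₀) + 1 - 1 = N * (1 - x₀) by ring,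
      mul_assoc]
    refine mul_le_mul (Real.rpow_le_rpow h0.le hx.1.le (mul_pos hN h0).le) ?_
      (mul_nonneg (Real.rpow_nonneg h1.le _) (Real.exp_pos _).le) (Real.rpow_nonneg hx0.le _)
    refine le_trans ?_ (Real.rpow_le_rpow (by positivity) hxlow (by positivity))
    rw [Real.mul_rpow h1.le (by positivity)]
    refine mul_le_mul_of_nonneg_left ?_ (by positivity)
    have hlog : -(1 / N) ≤ Real.log (N / (N + 1)) := by
      rw [← neg_le_neg_iff, neg_neg, ← Real.log_inv, inv_div]
      refine (Real.log_le_sub_one_of_pos (by positivity)).trans_eq ?_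
      field_simp
      ring
    rw [Real.rpow_def_of_pos (by positivity), Real.exp_le_exp]
    have h3 := mul_le_mul_of_nonneg_right hlog (by positivity : 0 ≤ N * (1 - x₀))
    have h4 : -(1 / N) * (N * (1 - x₀)) = -(1 - x₀) := by field_simp
    linarith
  have hint : (1 / c * (g * Real.exp (-1))) * h ≤ 1 := by
    have hI := integrable_betaPDFReal hα1 hβ1
    calc (1 / c * (g * Real.exp (-1))) * h
        = ∫ x in Set.Ioo x₀ (x₀ + h), (1 / c * (g * Real.exp (-1))) := by
          rw [setIntegral_const, measureReal_def, Real.volume_Ioo]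
          simp [hhpos.le, mul_comm]
      _ ≤ ∫ x in Set.Ioo x₀ (x₀ + h), betaPDFReal (N * x₀ + 1) (N * (1 - x₀) + 1) x :=
          setIntegral_mono_on (integrable_const _) hI.integrableOn
            measurableSet_Ioo hlow
      _ ≤ ∫ x, betaPDFReal (N * x₀ + 1) (N * (1 - x₀) + 1) x :=
          setIntegral_le_integral hI (ae_of_all _ (betaPDFReal_nonneg hα1 hβ1))
      _ = 1 := integral_betaPDFReal hα1 hβ1
  rw [Real.exp_neg, hh] at hint
  have he := Real.exp_pos 1
  have e1 : 1 / c * (g * (Real.exp 1)⁻¹) * ((1 - x₀) / (N + 1)) =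
      g / (Real.exp 1 * (N + 1) / (1 - x₀) * c) := by field_simp
  rw [e1, div_le_one (by positivity)] at hint
  exact hint

lemma modeBeta_le_smul (hN : 0 < N) (hx₀ : x₀ ∈ Set.Ioo (0 : ℝ) 1) :
    modeBeta N x₀ ≤ ENNReal.ofReal (Real.exp 1 * (N + 1) / (1 - x₀)) •
      volume.restrict (Set.Ioo (0 : ℝ) 1) := by
  have h1 : 0 < 1 - x₀ := sub_pos.2 hx₀.2
  have h0 : 0 < x₀ := hx₀.1
  have hα1 : 0 < N * x₀ + 1 := by positivity
  have hβ1 : 0 < N * (1 - x₀) + 1 := by positivity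
  have hc := beta_pos hα1 hβ1
  rw [← withDensity_const, ← withDensity_indicator measurableSet_Ioo,
    modeBeta, betaMeasure]
  refine withDensity_mono (ae_of_all _ fun x => ?_)
  by_cases hx : x ∈ Set.Ioo (0 : ℝ) 1
  · rw [Set.indicator_of_mem hx, betaPDF, betaPDFReal, if_pos ⟨hx.1, hx.2⟩]
    refine ENNReal.ofReal_le_ofReal ?_
    rw [show N * x₀ + 1 - 1 = N * x₀ by ring, show N * (1 - x₀) + 1 - 1 = N * (1 - x₀) by ring,
      mul_assoc, one_div, inv_mul_le_iff₀ hc, mul_comm (beta _ _)]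
    exact (beta_kernel_le_mode hN hx₀ hx).trans (beta_mode_le hN hx₀)
  · rw [betaPDF, betaPDFReal, if_neg (show ¬(0 < x ∧ x < 1) from hx)]
    simp

end BetaDistribution

section ConcentratedBeta

/-- The Beta distribution with mode `θ₀` and concentration `N`, rescaled to `(-1, 1)`. -/
noncomputable def concentratedBeta (N θ₀ : ℝ) : Measure ℝ :=
  (modeBeta N ((1 + θ₀) / 2)).map fun y => 2 * y - 1

lemma map_volume_Ioo_eq_uniformPrior :
    (volume.restrict (Set.Ioo (0 : ℝ) 1)).map (fun y : ℝ => 2 * y - 1) = uniformPrior := by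
  have hm : Measurable fun y : ℝ => 2 * y - 1 := by fun_prop
  have hpre : (fun y : ℝ => 2 * y - 1) ⁻¹' Set.Ioo (-1) 1 = Set.Ioo 0 1 := by
    ext y
    simp only [Set.mem_preimage, Set.mem_Ioo]
    constructor <;> rintro ⟨h1, h2⟩ <;> constructor <;> linarith
  have hmap : volume.map (fun y : ℝ => 2 * y - 1) = ENNReal.ofReal |2⁻¹| • volume := by
    have : (fun y : ℝ => 2 * y - 1) = (fun y => y - 1) ∘ (fun y => 2 * y) := rfl
    rw [this, ← Measure.map_map (by fun_prop) (by fun_prop), Real.map_volume_mul_left two_ne_zero,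
      Measure.map_smul, (measurePreserving_sub_right volume (1 : ℝ)).map_eq]
  rw [← hpre, ← Measure.restrict_map hm measurableSet_Ioo, hmap, Measure.restrict_smul,
    uniformPrior, ProbabilityTheory.cond, Real.volume_Ioo]
  congr 1
  rw [abs_of_pos (by norm_num), ENNReal.ofReal_inv_of_pos two_pos]
  norm_num

instance isProbabilityMeasure_uniformPrior : IsProbabilityMeasure uniformPrior :=
  cond_isProbabilityMeasure_of_finite (by simp [Real.volume_Ioo]) (by simp [Real.volume_Ioo])

variable {N θ₀ : ℝ}

lemma half_one_add_mem_Ioo (hθ₀ : |θ₀| < 1) : (1 + θ₀) / 2 ∈ Set.Ioo (0 : ℝ) 1 := by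
  have := abs_lt.1 hθ₀
  constructor <;> linarith

lemma isProbabilityMeasure_modeBeta {x₀ : ℝ} (hN : 0 < N) (hx₀ : x₀ ∈ Set.Ioo (0 : ℝ) 1) :
    IsProbabilityMeasure (modeBeta N x₀) := by
  have h1 : 0 < 1 - x₀ := sub_pos.2 hx₀.2
  have h0 : 0 < x₀ := hx₀.1
  exact isProbabilityMeasureBeta (by positivity) (by positivity)

lemma isProbabilityMeasure_concentratedBeta (hN : 0 < N) (hθ₀ : |θ₀| < 1) :
    IsProbabilityMeasure (concentratedBeta N θ₀) := by
  have := isProbabilityMeasure_modeBeta hN (half_one_add_mem_Ioo hθ₀)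
  exact Measure.isProbabilityMeasure_map (by fun_prop)

lemma concentratedBeta_mem_scaledBetaFamily (hN : 0 < N) (hθ₀ : |θ₀| < 1) :
    concentratedBeta N θ₀ ∈ scaledBetaFamily := by
  have hx₀ := half_one_add_mem_Ioo hθ₀
  have h1 := sub_pos.2 hx₀.2
  have h0 := hx₀.1
  exact ⟨_, _, by positivity, by positivity, rfl⟩

lemma klDiv_concentratedBeta_le (hN : 0 < N) (hθ₀ : |θ₀| < 1) :
    InformationTheory.klDiv (concentratedBeta N θ₀) uniformPrior ≤
      ENNReal.ofReal (Real.log (Real.exp 1 * (N + 1) / (1 - (1 + θ₀) / 2))) := by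
  have hx₀ := half_one_add_mem_Ioo hθ₀
  have := isProbabilityMeasure_concentratedBeta hN hθ₀
  refine klDiv_le_log_of_le_smul ?_ ?_
  · rw [le_div_iff₀ (sub_pos.2 hx₀.2), one_mul]
    have h1 := Real.one_le_exp (zero_le_one (α := ℝ))
    have h2 := hx₀.1
    nlinarith
  · rw [← map_volume_Ioo_eq_uniformPrior, ← Measure.map_smul]
    exact Measure.map_mono (modeBeta_le_smul hN hx₀) (by fun_prop)

lemma exists_klDiv_concentratedBeta_le_sqrt (hθ₀ : |θ₀| < 1) :
    ∃ C : ℝ, 0 < C ∧ ∀ n : ℕ, 1 ≤ n →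
      InformationTheory.klDiv (concentratedBeta ((n : ℝ) ^ 4) θ₀) uniformPrior ≤
        ENNReal.ofReal (C * √n) := by
  have hx₀ := half_one_add_mem_Ioo hθ₀
  have hx1 := sub_pos.2 hx₀.2
  have hL : Real.log (1 - (1 + θ₀) / 2) ≤ 0 :=
    Real.log_nonpos hx1.le (by linarith [hx₀.1])
  refine ⟨10 - Real.log (1 - (1 + θ₀) / 2), by linarith, fun n hn => ?_⟩
  have hn' : (1 : ℝ) ≤ n := by exact_mod_cast hn
  have hs : 1 ≤ √(n : ℝ) := Real.one_le_sqrt.2 hn'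
  refine (klDiv_concentratedBeta_le (by positivity) hθ₀).trans (ENNReal.ofReal_le_ofReal ?_)
  rw [Real.log_div (by positivity) hx1.ne', Real.log_mul (by positivity) (by positivity),
    Real.log_exp]
  have h1 : Real.log ((n : ℝ) ^ 4 + 1) ≤ 1 + 8 * √n := by
    have h2 : (n : ℝ) ^ 4 + 1 ≤ 2 * n ^ 4 := by
      have := one_le_pow₀ hn' (n := 4)
      linarith
    refine (Real.log_le_log (by positivity) h2).trans ?_
    rw [Real.log_mul (by norm_num) (by positivity), Real.log_pow]
    have h3 : Real.log 2 ≤ 1 := (Real.log_le_sub_one_of_pos two_pos).trans (by norm_num)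
    have h4 : Real.log n ≤ 2 * √n := by
      have h5 := Real.log_le_sub_one_of_pos (show 0 < √(n : ℝ) by positivity)
      rw [Real.log_sqrt (by positivity)] at h5
      linarith
    push_cast
    linarith
  nlinarith

/-- The weight `(θ - θ₀)² / (1 - θ²)` has integral `1 / N` under the concentrated law. -/
lemma integral_concentratedBeta_le (hN : 0 < N) (hθ₀ : |θ₀| < 1) {H : ℝ → ℝ} (hH : Measurable H)
    {K : ℝ} (h : ∀ θ ∈ Set.Ioo (-1 : ℝ) 1, |H θ| ≤ K * ((θ - θ₀) ^ 2 / (1 - θ ^ 2))) :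
    Integrable H (concentratedBeta N θ₀) ∧ ∫ θ, H θ ∂(concentratedBeta N θ₀) ≤ K / N := by
  have hx₀ := half_one_add_mem_Ioo hθ₀
  obtain ⟨hi, he⟩ := modeBeta_weighted_variance hN hx₀
  have hae : ∀ᵐ y ∂(modeBeta N ((1 + θ₀) / 2)),
      |H (2 * y - 1)| ≤ K * ((y - (1 + θ₀) / 2) ^ 2 / (y * (1 - y))) := by
    filter_upwards [ae_mem_Ioo_betaMeasure _ _] with y hy
    have hy1 := (sub_pos.2 hy.2).ne'
    have hy0 := hy.1.ne'
    refine (h (2 * y - 1) ⟨by linarith [hy.1], by linarith [hy.2]⟩).trans_eq ?_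
    congr 1
    rw [show 1 - (2 * y - 1) ^ 2 = 4 * (y * (1 - y)) by ring]
    field_simp
    ring
  have hHi : Integrable (fun y => H (2 * y - 1)) (modeBeta N ((1 + θ₀) / 2)) :=
    (hi.const_mul K).mono' (hH.comp (by fun_prop)).aestronglyMeasurable hae
  have hm : AEMeasurable (fun y : ℝ => 2 * y - 1) (modeBeta N ((1 + θ₀) / 2)) := by fun_prop
  refine ⟨(integrable_map_measure hH.aestronglyMeasurable hm).2 hHi, ?_⟩
  rw [concentratedBeta, integral_map hm hH.aestronglyMeasurable]
  refine (integral_mono_ae hHi (hi.const_mul K)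
    (hae.mono fun y hy => (le_abs_self _).trans hy)).trans_eq ?_
  rw [integral_const_mul, he, mul_one_div]

lemma sq_sub_le_weight {θ : ℝ} (hθ : θ ∈ Set.Ioo (-1 : ℝ) 1) :
    (θ - θ₀) ^ 2 ≤ (θ - θ₀) ^ 2 / (1 - θ ^ 2) := by
  have h : θ ^ 2 < 1 := (sq_lt_one_iff_abs_lt_one θ).2 (abs_lt.2 hθ)
  refine le_div_self (sq_nonneg _) (by linarith) (by linarith [sq_nonneg θ])

lemma abs_sub_rpow_le_weight (hθ₀ : |θ₀| < 1) {δ : ℝ} (hδ : 0 < δ) {θ : ℝ}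
    (hθ : θ ∈ Set.Ioo (-1 : ℝ) 1) :
    |θ - θ₀| ^ (2 + δ) ≤ 2 ^ δ * ((θ - θ₀) ^ 2 / (1 - θ ^ 2)) := by
  have h2 : |θ - θ₀| ≤ 2 := by
    have := abs_lt.1 hθ₀
    rw [abs_le]
    constructor <;> linarith [hθ.1, hθ.2]
  rw [add_comm, Real.rpow_add_of_nonneg (abs_nonneg _) hδ.le two_pos.le, Real.rpow_two, sq_abs]
  gcongr
  exact sq_sub_le_weight hθ

/-- The parameter function in the Lipschitz bound for the invariant densities. -/
noncomputable def invLogDensityGap (θ₂ θ₁ : ℝ) : ℝ :=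
  |Real.log (1 - θ₁ ^ 2) - Real.log (1 - θ₂ ^ 2)| + |θ₁ ^ 2 - θ₂ ^ 2|

lemma exists_invLogDensityGap_rpow_le (hθ₀ : |θ₀| < 1) {δ : ℝ} (hδ : 0 < δ) :
    ∃ K : ℝ, ∀ θ ∈ Set.Ioo (-1 : ℝ) 1,
      |invLogDensityGap θ θ₀| ^ (2 + δ) ≤ K * ((θ - θ₀) ^ 2 / (1 - θ ^ 2)) := by
  have hu₀ : 0 < 1 - θ₀ ^ 2 := sub_pos.2 ((sq_lt_one_iff_abs_lt_one θ₀).2 hθ₀)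
  set u₀ := 1 - θ₀ ^ 2 with hu₀'
  have hu₀1 : u₀ ≤ 1 := by linarith [sq_nonneg θ₀]
  set q := 2 + δ with hq
  have hq0 : 0 < q := by positivity
  refine ⟨(4 / u₀ + 2) ^ q * 2 ^ δ + (1 + q) ^ q * (16 / u₀ ^ 2), fun θ hθ => ?_⟩
  have hu : 0 < 1 - θ ^ 2 := sub_pos.2 ((sq_lt_one_iff_abs_lt_one θ).2 (abs_lt.2 hθ))
  have hw : 0 ≤ (θ - θ₀) ^ 2 / (1 - θ ^ 2) := by positivity
  have hrpow := abs_sub_rpow_le_weight hθ₀ hδ hθ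
  have hgap0 : 0 ≤ invLogDensityGap θ θ₀ := by unfold invLogDensityGap; positivity
  rw [abs_of_nonneg hgap0]
  have hsq : |θ₀ ^ 2 - θ ^ 2| ≤ 2 * |θ - θ₀| := by
    rw [show θ₀ ^ 2 - θ ^ 2 = -((θ + θ₀) * (θ - θ₀)) by ring, abs_neg, abs_mul]
    gcongr
    have := abs_lt.1 hθ₀
    rw [abs_le]
    constructor <;> linarith [hθ.1, hθ.2]
  set u := 1 - θ ^ 2 with hu'
  have huu : θ₀ ^ 2 - θ ^ 2 = u - u₀ := by rw [hu₀', hu']; ring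
  have hu1 : u ≤ 1 := by linarith [sq_nonneg θ]
  rw [add_mul]
  unfold invLogDensityGap
  rw [← hu', ← hu₀']
  rw [huu] at hsq ⊢
  rcases le_or_gt (u₀ / 2) u with hcase | hcase
  · refine le_add_of_le_of_nonneg ?_ (by positivity)
    have hlog : |Real.log u₀ - Real.log u| ≤ 2 / u₀ * |u - u₀| := by
      have a1 : Real.log u - Real.log u₀ ≤ (u - u₀) / u₀ := by
        rw [← Real.log_div hu.ne' hu₀.ne']
        refine (Real.log_le_sub_one_of_pos (by positivity)).trans_eq ?_
        field_simp
      have a2 : Real.log u₀ - Real.log u ≤ (u₀ - u) / u := by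
        rw [← Real.log_div hu₀.ne' hu.ne']
        refine (Real.log_le_sub_one_of_pos (by positivity)).trans_eq ?_
        field_simp
      have b1 : (u - u₀) / u₀ ≤ 2 / u₀ * |u - u₀| := by
        rw [div_mul_eq_mul_div]
        gcongr
        linarith [le_abs_self (u - u₀), abs_nonneg (u - u₀)]
      have b2 : (u₀ - u) / u ≤ 2 / u₀ * |u - u₀| := by
        rw [div_mul_eq_mul_div, div_le_div_iff₀ hu hu₀, abs_sub_comm]
        have c1 := le_abs_self (u₀ - u)
        have c2 := abs_nonneg (u₀ - u)
        nlinarith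
      rw [abs_le]
      constructor <;> linarith
    have hF : |Real.log u₀ - Real.log u| + |u - u₀| ≤ (4 / u₀ + 2) * |θ - θ₀| := by
      have h3 := mul_le_mul_of_nonneg_left hsq (show 0 ≤ 2 / u₀ by positivity)
      have h4 : 2 / u₀ * (2 * |θ - θ₀|) = 4 / u₀ * |θ - θ₀| := by ring
      linarith
    calc _ ≤ ((4 / u₀ + 2) * |θ - θ₀|) ^ q := Real.rpow_le_rpow (by positivity) hF hq0.le
      _ = (4 / u₀ + 2) ^ q * |θ - θ₀| ^ q := Real.mul_rpow (by positivity) (abs_nonneg _)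
      _ ≤ _ := by
        rw [mul_assoc]
        gcongr
  · refine le_add_of_nonneg_of_le (by positivity) ?_
    have ht : u₀ ^ 2 / 16 ≤ (θ - θ₀) ^ 2 := by
      have h3 : u₀ / 4 ≤ |θ - θ₀| := by
        have := neg_abs_le (u - u₀)
        linarith
      rw [← sq_abs (θ - θ₀)]
      calc u₀ ^ 2 / 16 = (u₀ / 4) ^ 2 := by ring
        _ ≤ _ := by gcongr
    have hF : |Real.log u₀ - Real.log u| + |u - u₀| ≤ (1 + q) * (1 / u) ^ (1 / q) := by
      have h1 : Real.log u ≤ Real.log u₀ := Real.log_le_log hu (by linarith)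
      have h2 : Real.log u₀ ≤ 0 := Real.log_nonpos hu₀.le hu₀1
      have h3 := Real.log_le_rpow_div (x := 1 / u) (ε := 1 / q) (by positivity) (by positivity)
      rw [one_div u, Real.log_inv, div_div_eq_mul_div, div_one, ← one_div u] at h3
      have h4 : 1 ≤ (1 / u) ^ (1 / q) :=
        Real.one_le_rpow ((one_le_div hu).2 hu1) (by positivity)
      rw [abs_of_nonneg (by linarith), abs_of_nonpos (by linarith)]
      nlinarith
    calc _ ≤ ((1 + q) * (1 / u) ^ (1 / q)) ^ q := Real.rpow_le_rpow (by positivity) hF hq0.le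
      _ = (1 + q) ^ q * (1 / u) := by
        rw [Real.mul_rpow (by positivity) (by positivity), ← Real.rpow_mul (by positivity),
          one_div_mul_cancel hq0.ne', Real.rpow_one]
      _ ≤ (1 + q) ^ q * (16 / u₀ ^ 2 * ((θ - θ₀) ^ 2 / u)) := by
        gcongr
        rw [← mul_div_assoc]
        gcongr
        rw [div_mul_eq_mul_div, le_div_iff₀ (by positivity)]
        linarith
      _ = _ := by ring

end ConcentratedBeta

section LinearModel

/-- The envelope of the log-likelihood increments of the linear model. -/
def ar1Envelope (y x : ℝ) : ℝ := 2 * (1 + x ^ 2 + y ^ 2)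

lemma ar1Envelope_pos (y x : ℝ) : 0 < ar1Envelope y x := by unfold ar1Envelope; positivity

lemma measurable_ar1Envelope : Measurable (Function.uncurry ar1Envelope) := by
  unfold ar1Envelope Function.uncurry; fun_prop

lemma log_transition_sub_log_transition (θ₁ θ₂ x y : ℝ) :
    Real.log (gaussianPDFReal (θ₁ * x) 1 y) - Real.log (gaussianPDFReal (θ₂ * x) 1 y) =
      ((y - θ₂ * x) ^ 2 - (y - θ₁ * x) ^ 2) / 2 := by
  rw [log_gaussianPDFReal _ one_ne_zero, log_gaussianPDFReal _ one_ne_zero]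
  simp only [NNReal.coe_one]
  ring

lemma abs_log_transition_sub_le {θ₁ θ₂ : ℝ} (h₁ : |θ₁| ≤ 1) (h₂ : |θ₂| ≤ 1) (x y : ℝ) :
    |((y - θ₂ * x) ^ 2 - (y - θ₁ * x) ^ 2) / 2| ≤ ar1Envelope y x * |θ₂ - θ₁| := by
  have e : ((y - θ₂ * x) ^ 2 - (y - θ₁ * x) ^ 2) / 2 =
      ((θ₁ + θ₂) / 2 * x ^ 2 - x * y) * (θ₂ - θ₁) := by ring
  rw [e, abs_mul]
  refine mul_le_mul_of_nonneg_right ?_ (abs_nonneg _)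
  have := abs_le.1 h₁
  have := abs_le.1 h₂
  unfold ar1Envelope
  rw [abs_le]
  constructor <;> nlinarith [sq_nonneg (x - y), sq_nonneg (x + y), sq_nonneg x, sq_nonneg y]

lemma ar1Envelope_rpow_le {δ : ℝ} (hδ : 0 < δ) (y x : ℝ) :
    ar1Envelope y x ^ (2 + δ) ≤
      8 ^ (2 + δ) * (1 + |x| ^ (4 + 2 * δ)) + 8 ^ (2 + δ) * |y| ^ (4 + 2 * δ) := by
  have hq : 0 ≤ 2 + δ := by positivity
  have hs : ∀ z : ℝ, (z ^ 2) ^ (2 + δ) = |z| ^ (4 + 2 * δ) := fun z => by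
    rw [← sq_abs, ← Real.rpow_two, ← Real.rpow_mul (abs_nonneg _)]
    congr 1; ring
  have h1 := add_rpow_le_two_rpow_mul (a := 1 + x ^ 2) (b := y ^ 2) (by positivity) (by positivity)
    hq
  have h2 := add_rpow_le_two_rpow_mul (a := 1) (b := x ^ 2) (by positivity) (by positivity) hq
  rw [hs] at h1 h2
  rw [Real.one_rpow] at h2
  have h8 : (8 : ℝ) ^ (2 + δ) = 2 ^ (2 + δ) * 2 ^ (2 + δ) * 2 ^ (2 + δ) := by
    rw [← Real.mul_rpow (by norm_num) (by norm_num), ← Real.mul_rpow (by norm_num) (by norm_num)]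
    norm_num
  have hone : 1 ≤ (2 : ℝ) ^ (2 + δ) := Real.one_le_rpow (by norm_num) hq
  rw [ar1Envelope, Real.mul_rpow (by norm_num) (by positivity), h8]
  set t := (2 : ℝ) ^ (2 + δ)
  have hy : 0 ≤ |y| ^ (4 + 2 * δ) := by positivity
  have h3 : t * (1 + x ^ 2 + y ^ 2) ^ (2 + δ) ≤
      t * (t * (t * (1 + |x| ^ (4 + 2 * δ)) + |y| ^ (4 + 2 * δ))) := by
    refine mul_le_mul_of_nonneg_left (h1.trans ?_) (by positivity)
    gcongr
  have h4 : t * t * |y| ^ (4 + 2 * δ) ≤ t * t * t * |y| ^ (4 + 2 * δ) := by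
    gcongr
    exact le_mul_of_one_le_right (by positivity) hone
  linarith

/-- The constant in the moment bound for the envelope. -/
noncomputable def envelopeConst (δ : ℝ) : ℝ :=
  8 ^ (2 + δ) * (1 + 2 ^ (4 + 2 * δ) * (1 + gaussianAbsMoment (4 + 2 * δ)))

lemma one_le_envelopeConst {δ : ℝ} (hδ : 0 < δ) : 1 ≤ envelopeConst δ := by
  have h := gaussianAbsMoment_nonneg (4 + 2 * δ)
  refine one_le_mul_of_one_le_of_one_le (Real.one_le_rpow (by norm_num) (by positivity)) ?_
  exact le_add_of_nonneg_right (by positivity)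

lemma lintegral_ar1Envelope_rpow_le {δ θ : ℝ} (hδ : 0 < δ) (hθ : |θ| ≤ 1) (x : ℝ) :
    ∫⁻ y, ENNReal.ofReal (ar1Envelope y x ^ (2 + δ)) ∂(ar1Kernel θ x) ≤
      ENNReal.ofReal (envelopeConst δ * (1 + |x| ^ (4 + 2 * δ))) := by
  have hs : 0 < 4 + 2 * δ := by positivity
  have hG := gaussianAbsMoment_nonneg (4 + 2 * δ)
  refine (lintegral_mono fun y => ENNReal.ofReal_le_ofReal (ar1Envelope_rpow_le hδ y x)).trans ?_
  have e : ∀ y : ℝ, ENNReal.ofReal (8 ^ (2 + δ) * (1 + |x| ^ (4 + 2 * δ)) +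
      8 ^ (2 + δ) * |y| ^ (4 + 2 * δ)) = ENNReal.ofReal (8 ^ (2 + δ) * (1 + |x| ^ (4 + 2 * δ))) +
      ENNReal.ofReal (8 ^ (2 + δ)) * ENNReal.ofReal (|y| ^ (4 + 2 * δ)) := fun y => by
    rw [ENNReal.ofReal_add (by positivity) (by positivity),
      ENNReal.ofReal_mul (p := 8 ^ (2 + δ)) (q := |y| ^ (4 + 2 * δ)) (by positivity)]
  simp only [e]
  rw [lintegral_add_left (by fun_prop), lintegral_const, measure_univ, mul_one,
    lintegral_const_mul _ (by fun_prop), ar1Kernel_apply]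
  refine (add_le_add_right (mul_le_mul_right (lintegral_abs_rpow_gaussianReal_le _ _ hs) _)
    _).trans ?_
  rw [← ENNReal.ofReal_mul (by positivity), ← ENNReal.ofReal_add (by positivity) (by positivity)]
  refine ENNReal.ofReal_le_ofReal ?_
  have h1 : |θ * x| ^ (4 + 2 * δ) ≤ |x| ^ (4 + 2 * δ) := by
    refine Real.rpow_le_rpow (abs_nonneg _) ?_ hs.le
    rw [abs_mul]
    exact mul_le_of_le_one_left (abs_nonneg _) hθ
  simp only [NNReal.coe_one, Real.sqrt_one, Real.one_rpow, one_mul]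
  unfold envelopeConst
  have hx : 0 ≤ |x| ^ (4 + 2 * δ) := by positivity
  set a := |x| ^ (4 + 2 * δ)
  set G := gaussianAbsMoment (4 + 2 * δ)
  have h2 : |θ * x| ^ (4 + 2 * δ) + G ≤ (1 + G) * (1 + a) := by nlinarith
  calc _ ≤ 8 ^ (2 + δ) * (1 + a) + 8 ^ (2 + δ) * (2 ^ (4 + 2 * δ) * ((1 + G) * (1 + a))) := by
        gcongr
    _ = _ := by ring

variable {initRef : Measure ℝ} {q₀ : ℝ → ℝ}

lemma invLaw_simpleLinearModel {θ : ℝ} (hθ : |θ| < 1) :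
    (simpleLinearModel initRef q₀).invLaw θ = gaussianReal 0 (ar1InvVar θ) :=
  (gaussianReal_of_var_ne_zero 0 (ar1InvVar_pos hθ).ne').symm

lemma isConsistent_simpleLinearModel (hq₀_nonneg : ∀ x, 0 ≤ q₀ x) (hq₀ : Measurable q₀)
    (hprob : IsProbabilityMeasure (initRef.withDensity fun x => ENNReal.ofReal (q₀ x))) :
    (simpleLinearModel initRef q₀).IsConsistent where
  init_nonneg := hq₀_nonneg
  init_measurable := hq₀
  init_prob := hprob
  trans_nonneg _ _ _ _ := gaussianPDFReal_nonneg _ _ _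
  trans_measurable θ _ := by
    simp only [simpleLinearModel, gaussianPDFReal]
    fun_prop
  kernel_eq θ _ x := gaussianReal_of_var_ne_zero (θ * x) one_ne_zero
  inv_nonneg _ _ _ := gaussianPDFReal_nonneg _ _ _
  inv_measurable _ _ := measurable_gaussianPDFReal _ _
  inv_prob θ hθ := by
    rw [invLaw_simpleLinearModel (abs_lt.2 hθ)]
    infer_instance
  inv_invariant θ hθ := by
    rw [invLaw_simpleLinearModel (abs_lt.2 hθ)]
    exact invariant_ar1Kernel (abs_lt.2 hθ)

lemma abs_log_invDensity_sub_le {θ₁ θ₂ : ℝ} (h₁ : |θ₁| < 1) (h₂ : |θ₂| < 1) (x : ℝ) :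
    |Real.log (gaussianPDFReal 0 (ar1InvVar θ₁) x) - Real.log (gaussianPDFReal 0 (ar1InvVar θ₂) x)|
      ≤ (1 + x ^ 2) * |invLogDensityGap θ₂ θ₁| := by
  have hlog : ∀ θ : ℝ, |θ| < 1 → Real.log (gaussianPDFReal 0 (ar1InvVar θ) x) =
      -(Real.log (2 * Real.pi) / 2) + Real.log (1 - θ ^ 2) / 2 - x ^ 2 * (1 - θ ^ 2) / 2 := by
    intro θ hθ
    have hu : 0 < 1 - θ ^ 2 := sub_pos.2 ((sq_lt_one_iff_abs_lt_one θ).2 hθ)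
    rw [log_gaussianPDFReal _ (ar1InvVar_pos hθ).ne', coe_ar1InvVar hθ,
      Real.log_mul (by positivity) (by positivity), one_div, Real.log_inv]
    field_simp
    ring
  rw [hlog _ h₁, hlog _ h₂]
  have hgap : 0 ≤ invLogDensityGap θ₂ θ₁ := by unfold invLogDensityGap; positivity
  rw [abs_of_nonneg hgap, invLogDensityGap]
  have e : -(Real.log (2 * Real.pi) / 2) + Real.log (1 - θ₁ ^ 2) / 2 - x ^ 2 * (1 - θ₁ ^ 2) / 2 -
      (-(Real.log (2 * Real.pi) / 2) + Real.log (1 - θ₂ ^ 2) / 2 - x ^ 2 * (1 - θ₂ ^ 2) / 2) =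
      (Real.log (1 - θ₁ ^ 2) - Real.log (1 - θ₂ ^ 2)) / 2 + x ^ 2 * (θ₁ ^ 2 - θ₂ ^ 2) / 2 := by ring
  rw [e]
  refine (abs_add_le _ _).trans ?_
  rw [abs_div, abs_div, abs_mul, abs_of_pos (two_pos : (0 : ℝ) < 2), abs_of_nonneg (sq_nonneg x)]
  have a1 := abs_nonneg (Real.log (1 - θ₁ ^ 2) - Real.log (1 - θ₂ ^ 2))
  have a2 := abs_nonneg (θ₁ ^ 2 - θ₂ ^ 2)
  have a3 := mul_nonneg (sq_nonneg x) a1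
  have a4 := mul_nonneg (sq_nonneg x) a2
  linarith

lemma genLipschitz_simpleLinearModel {δ θ₀ : ℝ} (hδ : 0 < δ) (hθ₀ : |θ₀| < 1)
    (hprob : IsProbabilityMeasure (initRef.withDensity fun x => ENNReal.ofReal (q₀ x)))
    (hmom : Integrable (fun x => |x| ^ (4 + 2 * δ))
      (initRef.withDensity fun x => ENNReal.ofReal (q₀ x))) :
    (simpleLinearModel initRef q₀).GenLipschitz θ₀ δ (fun n => concentratedBeta ((n : ℝ) ^ 4) θ₀) 1
      (fun _ => ar1Envelope) (fun _ x => 1 + x ^ 2) (fun _ θ₂ θ₁ => θ₂ - θ₁)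
      (fun _ => invLogDensityGap) where
  pos₁ _ := ar1Envelope_pos
  pos₂ _ x := by positivity
  measurable₁ _ := measurable_ar1Envelope
  measurable₂ _ := by fun_prop
  lip_trans θ₁ h₁ θ₂ h₂ x y := by
    rw [Fin.sum_univ_one]
    refine (congrArg abs (log_transition_sub_log_transition θ₁ θ₂ x y)).trans_le ?_
    exact abs_log_transition_sub_le (abs_lt.2 h₁).le (abs_lt.2 h₂).le x y
  lip_inv θ₁ h₁ θ₂ h₂ x := by
    rw [Fin.sum_univ_one]
    exact abs_log_invDensity_sub_le (abs_lt.2 h₁) (abs_lt.2 h₂) x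
  moment_f₁ _ := by
    refine ⟨2 ^ δ + 1, fun n hn => ?_⟩
    have hn' : (1 : ℝ) ≤ n := by exact_mod_cast hn
    have h := integral_concentratedBeta_le (N := (n : ℝ) ^ 4) (by positivity) hθ₀
      (H := fun θ => |θ - θ₀| ^ (2 + δ)) (by fun_prop) (K := 2 ^ δ) fun θ hθ => by
        rw [abs_of_nonneg (by positivity)]
        exact abs_sub_rpow_le_weight hθ₀ hδ hθ
    refine ⟨h.1, h.2.trans_lt ?_⟩
    calc (2 : ℝ) ^ δ / n ^ 4 ≤ 2 ^ δ / n := by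
          gcongr
          exact le_self_pow₀ hn' (by norm_num)
      _ < _ := by gcongr; linarith
  moment_f₂ _ := by
    obtain ⟨K, hK⟩ := exists_invLogDensityGap_rpow_le hθ₀ hδ
    refine ⟨|K| + 1, fun n hn => ?_⟩
    have hn' : (1 : ℝ) ≤ n := by exact_mod_cast hn
    have h := integral_concentratedBeta_le (N := (n : ℝ) ^ 4) (by positivity) hθ₀
      (H := fun θ => |invLogDensityGap θ θ₀| ^ (2 + δ))
      (by unfold invLogDensityGap; fun_prop) (K := K) fun θ hθ => by
        rw [abs_of_nonneg (by positivity)]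
        exact hK θ hθ
    refine ⟨h.1, h.2.trans_lt ?_⟩
    calc K / n ^ 4 ≤ |K| / n ^ 4 := by gcongr; exact le_abs_self K
      _ ≤ |K| / n := by
          gcongr
          exact le_self_pow₀ hn' (by norm_num)
      _ < _ := by gcongr; linarith
  moment_M₁ := by
    have hV : Integrable (fun x => envelopeConst δ * (1 + |x| ^ (4 + 2 * δ)))
      (initRef.withDensity fun x => ENNReal.ofReal (q₀ x)) :=
      ((integrable_const _).add hmom).const_mul _
    have hfin := hV.lintegral_lt_top
    refine ⟨ENNReal.toReal (∫⁻ x, ENNReal.ofReal (envelopeConst δ * (1 + |x| ^ (4 + 2 * δ)))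
      ∂(initRef.withDensity fun x => ENNReal.ofReal (q₀ x))) + 1, fun _ θ hθ => ?_⟩
    refine (lintegral_mono fun x =>
      lintegral_ar1Envelope_rpow_le hδ (abs_lt.2 hθ).le x).trans_lt ?_
    exact (ENNReal.lt_ofReal_iff_toReal_lt hfin.ne).2 (lt_add_one _)

lemma nonstationaryConditions_simpleLinearModel {Ω : Type*} [MeasurableSpace Ω] {P : Measure Ω}
    {X : ℕ → Ω → ℝ} {δ θ₀ : ℝ} (hδ : 0 < δ) (hθ₀ : |θ₀| < 1) (hq₀_nonneg : ∀ x, 0 ≤ q₀ x)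
    (hq₀ : Measurable q₀)
    (hprob : IsProbabilityMeasure (initRef.withDensity fun x => ENNReal.ofReal (q₀ x)))
    (hmom : Integrable (fun x => |x| ^ (4 + 2 * δ))
      (initRef.withDensity fun x => ENNReal.ofReal (q₀ x)))
    (hX : HasLaw (fun ω n => X n ω) (chainLaw (ar1Kernel θ₀)
      (initRef.withDensity fun x => ENNReal.ofReal (q₀ x))) P) :
    (simpleLinearModel initRef q₀).NonstationaryConditions P X θ₀ δ uniformPrior
      fun n => concentratedBeta ((n : ℝ) ^ 4) θ₀ where
  consistent := isConsistent_simpleLinearModel hq₀_nonneg hq₀ hprob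
  mem_paramSet := abs_lt.1 hθ₀
  generated := hX
  aperiodic := isAperiodic_ar1Kernel θ₀
  lipschitz_ergodic := by
    have hC := one_le_envelopeConst hδ
    refine ⟨1, _, _, _, _, fun x => (envelopeConst δ + 1) * (1 + |x| ^ (4 + 2 * δ)),
      genLipschitz_simpleLinearModel hδ hθ₀ hprob hmom, by fun_prop, fun x => ?_, ?_,
      fun _ x => ?_, ?_⟩
    · have : 0 ≤ |x| ^ (4 + 2 * δ) := by positivity
      nlinarith
    · rw [invLaw_simpleLinearModel hθ₀]
      exact isVGeometricallyErgodic_ar1Kernel hθ₀ (by positivity) (by positivity)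
    · refine (lintegral_ar1Envelope_rpow_le hδ hθ₀.le x).trans_lt ?_
      rw [ENNReal.ofReal_lt_ofReal_iff (by positivity)]
      have : 0 ≤ |x| ^ (4 + 2 * δ) := by positivity
      nlinarith
    · exact (((integrable_const _).add hmom).const_mul _).lintegral_lt_top
  kl_prior := exists_klDiv_concentratedBeta_le_sqrt hθ₀

end LinearModel

section PathLogRatio

/-- The logarithm of `p_{θ₀}(y | x) / p_θ(y | x)` in the linear model. -/
noncomputable def ar1LogRatio (θ₀ θ x y : ℝ) : ℝ := ((y - θ * x) ^ 2 - (y - θ₀ * x) ^ 2) / 2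

lemma measurable_ar1LogRatio (θ₀ θ : ℝ) : Measurable (Function.uncurry (ar1LogRatio θ₀ θ)) := by
  unfold ar1LogRatio Function.uncurry; fun_prop

lemma ar1Kernel_eq_withDensity (θ₀ θ x : ℝ) :
    ar1Kernel θ₀ x = (ar1Kernel θ x).withDensity
      fun y => ENNReal.ofReal (Real.exp (ar1LogRatio θ₀ θ x y)) := by
  rw [ar1Kernel_apply, ar1Kernel_apply, gaussianReal_of_var_ne_zero _ one_ne_zero,
    gaussianReal_of_var_ne_zero _ one_ne_zero,
    ← withDensity_mul _ (measurable_gaussianPDF _ _) (by unfold ar1LogRatio; fun_prop)]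
  congr 1
  funext y
  rw [Pi.mul_apply, gaussianPDF, gaussianPDF, ← ENNReal.ofReal_mul (gaussianPDFReal_nonneg _ _ _)]
  congr 1
  rw [gaussianPDFReal, gaussianPDFReal, mul_assoc (√(2 * Real.pi * ((1 : ℝ≥0) : ℝ)))⁻¹,
    ← Real.exp_add, ar1LogRatio]
  congr 2
  simp only [NNReal.coe_one]
  ring

lemma measurable_transitionSum_ar1LogRatio (θ₀ : ℝ) (n : ℕ) :
    Measurable fun p : ℝ × (Fin (n + 1) → ℝ) => transitionSum (ar1LogRatio θ₀ p.1) n p.2 := by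
  unfold transitionSum ar1LogRatio
  fun_prop

/-- The sum of the envelopes along a path. -/
def envelopeSum (n : ℕ) (x : Fin (n + 1) → ℝ) : ℝ :=
  transitionSum (fun x y => ar1Envelope y x) n x

lemma measurable_envelopeSum (n : ℕ) : Measurable (envelopeSum n) := by
  unfold envelopeSum transitionSum ar1Envelope
  fun_prop

lemma envelopeSum_nonneg (n : ℕ) (x : Fin (n + 1) → ℝ) : 0 ≤ envelopeSum n x := by
  unfold envelopeSum transitionSum
  exact Finset.sum_nonneg fun _ _ => (ar1Envelope_pos _ _).le

lemma abs_transitionSum_ar1LogRatio_le {θ₀ θ : ℝ} (hθ₀ : |θ₀| ≤ 1) (hθ : |θ| ≤ 1) (n : ℕ)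
    (x : Fin (n + 1) → ℝ) :
    |transitionSum (ar1LogRatio θ₀ θ) n x| ≤ |θ - θ₀| * envelopeSum n x := by
  unfold envelopeSum transitionSum
  rw [Finset.mul_sum]
  refine (Finset.abs_sum_le_sum_abs _ _).trans (Finset.sum_le_sum fun i _ => ?_)
  rw [mul_comm]
  exact abs_log_transition_sub_le hθ₀ hθ _ _

lemma sq_envelopeSum_le (n : ℕ) (ω : ℕ → ℝ) :
    envelopeSum n (initialSegment ℝ n ω) ^ 2 ≤
      n * ∑ i : Fin n, 12 * (1 + |ω i| ^ (4 : ℝ) + |ω (i + 1)| ^ (4 : ℝ)) := by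
  have h := sq_sum_le_card_mul_sum_sq (s := (Finset.univ : Finset (Fin n)))
    (f := fun i => ar1Envelope (initialSegment ℝ n ω i.succ) (initialSegment ℝ n ω i.castSucc))
  rw [Finset.card_univ, Fintype.card_fin] at h
  refine h.trans ?_
  gcongr with i
  have h4 : ∀ z : ℝ, |z| ^ (4 : ℝ) = (z ^ 2) ^ 2 := fun z => by
    rw [show (4 : ℝ) = ((4 : ℕ) : ℝ) by norm_num, Real.rpow_natCast, ← sq_abs z]; ring
  rw [h4, h4]
  simp only [initialSegment, Fin.val_succ, Fin.val_castSucc, ar1Envelope]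
  nlinarith [sq_nonneg (ω i ^ 2 - 1), sq_nonneg (ω (i + 1) ^ 2 - 1),
    sq_nonneg (ω i ^ 2 - ω (i + 1) ^ 2)]

lemma exists_integral_sq_envelopeSum_le {θ₀ : ℝ} (hθ₀ : |θ₀| < 1) (ν : Measure ℝ)
    [IsProbabilityMeasure ν] (hν : Integrable (fun x => |x| ^ (4 : ℝ)) ν) :
    ∃ K : ℝ, 0 ≤ K ∧ ∀ n : ℕ,
      Integrable (fun x => envelopeSum n x ^ 2)
        ((chainLaw (ar1Kernel θ₀) ν).map (initialSegment ℝ n)) ∧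
      ∫ x, envelopeSum n x ^ 2 ∂((chainLaw (ar1Kernel θ₀) ν).map (initialSegment ℝ n)) ≤
        K * n ^ 2 := by
  set c : ℝ := 2 ^ (4 : ℝ) * (1 + √(ar1InvVar θ₀) ^ (4 : ℝ) * gaussianAbsMoment 4)
  have hc : 0 ≤ c := by
    have := gaussianAbsMoment_nonneg 4
    positivity
  set m := ∫ x, c * (1 + |x| ^ (4 : ℝ)) ∂ν
  have hm : 0 ≤ m := integral_nonneg fun x => by positivity
  have hVi : Integrable (fun x => c * (1 + |x| ^ (4 : ℝ))) ν :=
    ((integrable_const _).add hν).const_mul _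
  have hlin : ∀ i : ℕ, ∫⁻ ω, ENNReal.ofReal (|ω i| ^ (4 : ℝ)) ∂(chainLaw (ar1Kernel θ₀) ν) ≤
      ENNReal.ofReal m := by
    intro i
    rw [lintegral_apply_chainLaw _ _ i (f := fun y => ENNReal.ofReal (|y| ^ (4 : ℝ)))
      (by fun_prop), ofReal_integral_eq_lintegral_ofReal hVi
      (ae_of_all _ fun x => by positivity)]
    exact lintegral_mono fun x => lintegral_abs_rpow_pow_ar1Kernel_le hθ₀ (by norm_num) i x
  have hint : ∀ i : ℕ, Integrable (fun ω : ℕ → ℝ => |ω i| ^ (4 : ℝ))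
      (chainLaw (ar1Kernel θ₀) ν) := by
    intro i
    refine ⟨(by fun_prop : Measurable fun ω : ℕ → ℝ => |ω i| ^ (4 : ℝ)).aestronglyMeasurable, ?_⟩
    rw [hasFiniteIntegral_iff_ofReal (ae_of_all _ fun ω => by positivity)]
    exact (hlin i).trans_lt ENNReal.ofReal_lt_top
  have hle : ∀ i : ℕ, ∫ ω, |ω i| ^ (4 : ℝ) ∂(chainLaw (ar1Kernel θ₀) ν) ≤ m := by
    intro i
    rw [integral_eq_lintegral_of_nonneg_ae (ae_of_all _ fun ω => by positivity)
      (hint i).aestronglyMeasurable]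
    exact ENNReal.toReal_le_of_le_ofReal hm (hlin i)
  refine ⟨12 * (1 + m + m), by positivity, fun n => ?_⟩
  have hterm : ∀ i : Fin n, Integrable
      (fun ω : ℕ → ℝ => 12 * (1 + |ω i| ^ (4 : ℝ) + |ω (i + 1)| ^ (4 : ℝ)))
      (chainLaw (ar1Kernel θ₀) ν) := fun i =>
    (((integrable_const _).add (hint i)).add (hint (i + 1))).const_mul _
  have hG := (integrable_finsetSum Finset.univ fun i _ => hterm i).const_mul (n : ℝ)
  have hmeas : Measurable fun x => envelopeSum n x ^ 2 := (measurable_envelopeSum n).pow_const 2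
  have hS : Integrable (fun ω => envelopeSum n (initialSegment ℝ n ω) ^ 2)
      (chainLaw (ar1Kernel θ₀) ν) :=
    hG.mono' (hmeas.comp (measurable_initialSegment n)).aestronglyMeasurable
      (ae_of_all _ fun ω => by
        rw [Real.norm_of_nonneg (sq_nonneg _)]
        exact sq_envelopeSum_le n ω)
  refine ⟨(integrable_map_measure hmeas.aestronglyMeasurable (by fun_prop)).2 hS, ?_⟩
  rw [integral_map (by fun_prop) hmeas.aestronglyMeasurable]
  refine (integral_mono hS hG fun ω => sq_envelopeSum_le n ω).trans ?_
  rw [integral_const_mul, integral_finsetSum _ fun i _ => hterm i]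
  have hsum : ∀ i : Fin n, ∫ ω, 12 * (1 + |ω i| ^ (4 : ℝ) + |ω (i + 1)| ^ (4 : ℝ))
      ∂(chainLaw (ar1Kernel θ₀) ν) ≤ 12 * (1 + m + m) := by
    intro i
    rw [integral_const_mul, integral_add (by exact (integrable_const _).add (hint i))
      (hint (i + 1)), integral_add (integrable_const _) (hint i)]
    simp only [integral_const, probReal_univ, smul_eq_mul, mul_one]
    have := hle i
    have := hle (i + 1)
    linarith
  have h2 := Finset.sum_le_sum (s := Finset.univ) fun i _ => hsum i
  rw [Finset.sum_const, Finset.card_univ, Fintype.card_fin, nsmul_eq_mul] at h2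
  have h3 := mul_le_mul_of_nonneg_left h2 (Nat.cast_nonneg (α := ℝ) n)
  refine h3.trans_eq ?_
  ring

end PathLogRatio

section PACBayes

variable {initRef : Measure ℝ} {q₀ : ℝ → ℝ}

lemma logRatio_simpleLinearModel (n : ℕ) (θ θ₀ : ℝ) {x : Fin (n + 1) → ℝ} (hx : q₀ (x 0) ≠ 0) :
    (simpleLinearModel initRef q₀).logRatio n θ θ₀ x = transitionSum (ar1LogRatio θ₀ θ) n x := by
  unfold Model.logRatio Model.pathDensity transitionSum
  change Real.log (q₀ (x 0) * _ / (q₀ (x 0) * _)) = _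
  rw [mul_div_mul_left _ _ hx, ← Finset.prod_div_distrib, Real.log_prod]
  · refine Finset.sum_congr rfl fun i _ => ?_
    rw [Real.log_div]
    · exact log_transition_sub_log_transition θ₀ θ _ _
    · exact (gaussianPDFReal_pos _ _ _ one_ne_zero).ne'
    · exact (gaussianPDFReal_pos _ _ _ one_ne_zero).ne'
  · intro i _
    exact (div_pos (gaussianPDFReal_pos _ _ _ one_ne_zero)
      (gaussianPDFReal_pos _ _ _ one_ne_zero)).ne'

lemma logRatio_simpleLinearModel_ae_eq (hq₀ : Measurable q₀)
    (_ : IsProbabilityMeasure (initRef.withDensity fun x => ENNReal.ofReal (q₀ x)))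
    (n : ℕ) (θ θ₀ : ℝ) :
    (simpleLinearModel initRef q₀).logRatio n θ θ₀
      =ᵐ[(simpleLinearModel initRef q₀).pathLaw θ₀ n] transitionSum (ar1LogRatio θ₀ θ) n := by
  set ν := initRef.withDensity fun x => ENNReal.ofReal (q₀ x) with hν
  have h0 : ∀ᵐ x ∂ν, q₀ x ≠ 0 := by
    rw [hν, ae_withDensity_iff (by fun_prop)]
    exact ae_of_all _ fun x h h' => h (by rw [h', ENNReal.ofReal_zero])
  rw [← map_zero_chainLaw (ar1Kernel θ₀) ν] at h0
  have h1 := ae_of_ae_map (measurable_pi_apply 0).aemeasurable h0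
  change _ =ᵐ[(chainLaw (ar1Kernel θ₀) ν).map (initialSegment ℝ n)] _
  have hset : MeasurableSet {x : Fin (n + 1) → ℝ | q₀ (x 0) ≠ 0} :=
    (hq₀.comp (measurable_pi_apply 0)) (measurableSet_singleton 0).compl
  have h2 : ∀ᵐ x ∂((chainLaw (ar1Kernel θ₀) ν).map (initialSegment ℝ n)), q₀ (x 0) ≠ 0 :=
    (ae_map_iff (by fun_prop) hset).2 h1
  filter_upwards [h2] with x hx
  exact logRatio_simpleLinearModel n θ θ₀ hx

lemma pacBayesConditions_simpleLinearModel {θ₀ : ℝ} (hθ₀ : |θ₀| < 1) (hq₀ : Measurable q₀)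
    (hprob : IsProbabilityMeasure (initRef.withDensity fun x => ENNReal.ofReal (q₀ x)))
    {n : ℕ} (hn : 1 ≤ n) {K ε : ℝ} (hK : 0 ≤ K)
    (hint : Integrable (fun x => envelopeSum n x ^ 2)
      ((simpleLinearModel initRef q₀).pathLaw θ₀ n))
    (hle : ∫ x, envelopeSum n x ^ 2 ∂((simpleLinearModel initRef q₀).pathLaw θ₀ n) ≤ K * n ^ 2)
    (hε : 1 + K ≤ n * ε)
    (hkl : InformationTheory.klDiv (concentratedBeta ((n : ℝ) ^ 4) θ₀) uniformPrior ≤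
      ENNReal.ofReal (n * ε)) :
    (simpleLinearModel initRef q₀).PACBayesConditions θ₀ uniformPrior n
      (concentratedBeta ((n : ℝ) ^ 4) θ₀) ε := by
  set ν := initRef.withDensity fun x => ENNReal.ofReal (q₀ x) with hν
  set M := simpleLinearModel initRef q₀ with hM
  set Q := M.pathLaw θ₀ n with hQ
  set ρ := concentratedBeta ((n : ℝ) ^ 4) θ₀ with hρ
  have hn' : (1 : ℝ) ≤ n := by exact_mod_cast hn
  have hN : (0 : ℝ) < (n : ℝ) ^ 4 := by positivity
  have hpath : ∀ θ, M.pathLaw θ n = (chainLaw (ar1Kernel θ) ν).map (initialSegment ℝ n) :=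
    fun θ => rfl
  have hprobPath : ∀ θ, IsProbabilityMeasure (M.pathLaw θ n) := fun θ => by
    rw [hpath]
    exact Measure.isProbabilityMeasure_map (by fun_prop)
  have hQp : IsProbabilityMeasure Q := hprobPath θ₀
  have hρp : IsProbabilityMeasure ρ := isProbabilityMeasure_concentratedBeta hN hθ₀
  set R : ℝ → (Fin (n + 1) → ℝ) → ℝ := fun θ => transitionSum (ar1LogRatio θ₀ θ) n
  have hRm : ∀ θ, Measurable (R θ) := fun θ =>
    measurable_transitionSum (measurable_ar1LogRatio θ₀ θ) n
  have hRae : ∀ θ, M.logRatio n θ θ₀ =ᵐ[Q] R θ := fun θ =>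
    logRatio_simpleLinearModel_ae_eq hq₀ hprob n θ θ₀
  have hSL : MemLp (envelopeSum n) 2 Q :=
    (memLp_two_iff_integrable_sq (measurable_envelopeSum n).aestronglyMeasurable).2 hint
  have hSi : Integrable (envelopeSum n) Q := hSL.integrable (by norm_num)
  have hES : ∫ x, envelopeSum n x ∂Q ≤ (1 + K) * n ^ 2 := by
    have h1 : ∫ x, envelopeSum n x ∂Q ≤ ∫ x, (1 + envelopeSum n x ^ 2) ∂Q :=
      integral_mono hSi ((integrable_const _).add hint) fun x => by
        change envelopeSum n x ≤ 1 + envelopeSum n x ^ 2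
        nlinarith [sq_nonneg (envelopeSum n x - 1)]
    rw [integral_add (integrable_const _) hint] at h1
    simp only [integral_const, probReal_univ, smul_eq_mul, mul_one] at h1
    have h2 := one_le_pow₀ hn' (n := 2)
    linarith
  have hI : Set.Ioo (-1 : ℝ) 1 = M.paramSet := rfl
  have hRle : ∀ θ ∈ Set.Ioo (-1 : ℝ) 1, ∀ x, |R θ x| ≤ |θ - θ₀| * envelopeSum n x :=
    fun θ hθ x => abs_transitionSum_ar1LogRatio_le hθ₀.le (abs_lt.2 hθ).le n x
  have hRL : ∀ θ ∈ Set.Ioo (-1 : ℝ) 1, MemLp (R θ) 2 Q := fun θ hθ =>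
    (hSL.const_mul |θ - θ₀|).mono (hRm θ).aestronglyMeasurable (ae_of_all _ fun x => by
      rw [Real.norm_eq_abs, Real.norm_of_nonneg (mul_nonneg (abs_nonneg _) (envelopeSum_nonneg n x))]
      exact hRle θ hθ x)
  have hρI : ∀ᵐ θ ∂ρ, θ ∈ Set.Ioo (-1 : ℝ) 1 := by
    have hac : ρ ≪ uniformPrior :=
      (InformationTheory.klDiv_ne_top_iff.1 (ne_top_of_le_ne_top ENNReal.ofReal_ne_top hkl)).1
    exact hac.ae_le (ae_cond_mem measurableSet_Ioo)
  obtain ⟨hsqi, hsq⟩ := integral_concentratedBeta_le hN hθ₀ (H := fun θ => (θ - θ₀) ^ 2)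
    (by fun_prop) (K := 1) fun θ hθ => by
      rw [abs_of_nonneg (sq_nonneg _), one_mul]
      exact sq_sub_le_weight hθ
  have hjm := (measurable_transitionSum_ar1LogRatio θ₀ n).stronglyMeasurable
  have hmm : StronglyMeasurable fun θ => ∫ x, R θ x ∂Q := hjm.integral_prod_right'
  have hmean_eq : ∀ θ, ∫ x, M.logRatio n θ θ₀ x ∂Q = ∫ x, R θ x ∂Q :=
    fun θ => integral_congr_ae (hRae θ)
  have hvar_eq : ∀ θ, variance (M.logRatio n θ θ₀) Q = variance (R θ) Q :=
    fun θ => variance_congr (hRae θ)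
  have hmean_le : ∀ θ ∈ Set.Ioo (-1 : ℝ) 1,
      |∫ x, R θ x ∂Q| ≤ (1 + K) * ((1 + n ^ 4 * (θ - θ₀) ^ 2) / 2) := by
    intro θ hθ
    calc |∫ x, R θ x ∂Q| ≤ ∫ x, |R θ x| ∂Q := abs_integral_le_integral_abs
      _ ≤ ∫ x, |θ - θ₀| * envelopeSum n x ∂Q :=
          integral_mono ((hRL θ hθ).integrable (by norm_num)).abs (hSi.const_mul _) (hRle θ hθ)
      _ = |θ - θ₀| * ∫ x, envelopeSum n x ∂Q := integral_const_mul _ _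
      _ ≤ |θ - θ₀| * ((1 + K) * n ^ 2) := by gcongr
      _ = (1 + K) * (|θ - θ₀| * n ^ 2) := by ring
      _ ≤ _ := by
          gcongr
          rw [← sq_abs (θ - θ₀)]
          nlinarith [sq_nonneg (|θ - θ₀| * n ^ 2 - 1)]
  have hdom : Integrable (fun θ => (1 + K) * ((1 + n ^ 4 * (θ - θ₀) ^ 2) / 2)) ρ :=
    (((integrable_const _).add (hsqi.const_mul _)).div_const 2).const_mul _
  have hmi : Integrable (fun θ => ∫ x, R θ x ∂Q) ρ :=
    hdom.mono' hmm.aestronglyMeasurable (hρI.mono hmean_le)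
  have hmle : ∫ θ, ∫ x, R θ x ∂Q ∂ρ ≤ n * ε := by
    refine (integral_mono_ae hmi hdom
      (hρI.mono fun θ hθ => (le_abs_self _).trans (hmean_le θ hθ))).trans (le_trans ?_ hε)
    rw [integral_const_mul, integral_div, integral_add (integrable_const _) (hsqi.const_mul _),
      integral_const_mul]
    simp only [integral_const, probReal_univ, smul_eq_mul, mul_one]
    have h1 : (n : ℝ) ^ 4 * ∫ θ, (θ - θ₀) ^ 2 ∂ρ ≤ 1 := by
      rw [le_div_iff₀ hN] at hsq
      linarith
    have h2 : (1 + (n : ℝ) ^ 4 * ∫ θ, (θ - θ₀) ^ 2 ∂ρ) / 2 ≤ 1 := by linarith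
    exact mul_le_of_le_one_right (by positivity) h2
  have hsqm : StronglyMeasurable fun θ => ∫ x, R θ x ^ 2 ∂Q :=
    StronglyMeasurable.integral_prod_right' (f := fun p : ℝ × (Fin (n + 1) → ℝ) => R p.1 p.2 ^ 2)
      ((measurable_transitionSum_ar1LogRatio θ₀ n).pow_const 2).stronglyMeasurable
  have hvar_sub : ∀ θ ∈ Set.Ioo (-1 : ℝ) 1, variance (R θ) Q =
      (∫ x, R θ x ^ 2 ∂Q) - (∫ x, R θ x ∂Q) ^ 2 := fun θ hθ => variance_eq_sub (hRL θ hθ)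
  have hvar_le : ∀ θ ∈ Set.Ioo (-1 : ℝ) 1, variance (R θ) Q ≤ K * n ^ 2 * (θ - θ₀) ^ 2 := by
    intro θ hθ
    rw [hvar_sub θ hθ]
    have h1 : ∫ x, R θ x ^ 2 ∂Q ≤ ∫ x, (θ - θ₀) ^ 2 * envelopeSum n x ^ 2 ∂Q :=
      integral_mono (hRL θ hθ).integrable_sq (hint.const_mul _) fun x => by
        change R θ x ^ 2 ≤ (θ - θ₀) ^ 2 * envelopeSum n x ^ 2
        rw [← sq_abs, ← sq_abs (θ - θ₀), ← mul_pow]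
        exact pow_le_pow_left₀ (abs_nonneg _) (hRle θ hθ x) 2
    rw [integral_const_mul] at h1
    have h2 := mul_le_mul_of_nonneg_left hle (sq_nonneg (θ - θ₀))
    have h3 := sq_nonneg (∫ x, R θ x ∂Q)
    linarith
  have hvm : AEStronglyMeasurable (fun θ => variance (R θ) Q) ρ :=
    ((hsqm.sub (hmm.pow 2)).aestronglyMeasurable).congr
      (hρI.mono fun θ hθ => (hvar_sub θ hθ).symm)
  have hvi : Integrable (fun θ => variance (R θ) Q) ρ :=
    (hsqi.const_mul (K * n ^ 2)).mono' hvm (hρI.mono fun θ hθ => by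
      rw [Real.norm_of_nonneg (variance_nonneg _ _)]
      exact hvar_le θ hθ)
  have hvle : ∫ θ, variance (R θ) Q ∂ρ ≤ n * ε := by
    refine (integral_mono_ae hvi (hsqi.const_mul (K * n ^ 2)) (hρI.mono hvar_le)).trans
      (le_trans ?_ hε)
    rw [integral_const_mul]
    calc K * n ^ 2 * ∫ θ, (θ - θ₀) ^ 2 ∂ρ ≤ K * n ^ 2 * (1 / n ^ 4) := by gcongr
      _ = K / n ^ 2 := by field_simp
      _ ≤ K := div_le_self hK (one_le_pow₀ hn')
      _ ≤ 1 + K := by linarith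
  have hkl_eq : ∀ θ ∈ Set.Ioo (-1 : ℝ) 1,
      InformationTheory.klDiv Q (M.pathLaw θ n) = ENNReal.ofReal (∫ x, R θ x ∂Q) ∧
        0 ≤ ∫ x, R θ x ∂Q := by
    intro θ hθ
    have := hprobPath θ
    refine klDiv_withDensity_exp (hRm θ) ?_ ((hRL θ hθ).integrable (by norm_num))
    exact map_initialSegment_chainLaw_eq_withDensity (ar1Kernel θ₀) (ar1Kernel θ) ν
      (measurable_ar1LogRatio θ₀ θ) (ar1Kernel_eq_withDensity θ₀ θ) n
  refine ⟨fun θ hθ => (memLp_congr_ae (hRae θ)).2 (hRL θ hθ), ?_, ?_, ?_, ?_, ?_, hkl⟩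
  · change Integrable (fun θ => ∫ x, M.logRatio n θ θ₀ x ∂Q) ρ
    simpa only [hmean_eq] using hmi
  · change ∫⁻ θ, InformationTheory.klDiv Q (M.pathLaw θ n) ∂ρ =
      ENNReal.ofReal (∫ θ, ∫ x, M.logRatio n θ θ₀ x ∂Q ∂ρ)
    simp only [hmean_eq]
    rw [ofReal_integral_eq_lintegral_ofReal hmi (hρI.mono fun θ hθ => (hkl_eq θ hθ).2)]
    exact lintegral_congr_ae (hρI.mono fun θ hθ => (hkl_eq θ hθ).1)
  · change ∫ θ, ∫ x, M.logRatio n θ θ₀ x ∂Q ∂ρ ≤ n * ε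
    simpa only [hmean_eq] using hmle
  · change Integrable (fun θ => variance (M.logRatio n θ θ₀) Q) ρ
    simpa only [hvar_eq] using hvi
  · change ∫ θ, variance (M.logRatio n θ θ₀) Q ∂ρ ≤ n * ε
    simpa only [hvar_eq] using hvle

end PACBayes

end MarkovVB

theorem mainTheorem11 {Ω : Type*} [MeasurableSpace Ω] (P : Measure Ω) [IsProbabilityMeasure P]
    (δ θ₀ : ℝ) (hδ : 0 < δ) (hθ₀ : |θ₀| < (2 : ℝ) ^ (1 / (4 + 2 * δ) - 1))
    (X W : ℕ → Ω → ℝ)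
    (hW : ∀ n, HasLaw (W n) (gaussianReal 0 1) P)
    (hW_indep : iIndepFun W P)
    (hX_W : IndepFun (X 0) (fun ω n => W n ω) P)
    (hX : ∀ n ω, X (n + 1) ω = θ₀ * X n ω + W n ω)
    (initRef : Measure ℝ) (q₀ : ℝ → ℝ) (hq₀_nonneg : ∀ x, 0 ≤ q₀ x) (hq₀ : Measurable q₀)
    (hX₀ : HasLaw (X 0) (initRef.withDensity (fun x => ENNReal.ofReal (q₀ x))) P)
    (hmoment : Integrable (fun ω => |X 0 ω| ^ (4 + 2 * δ)) P) :
    ∃ ρ : ℕ → Measure ℝ, (∀ n, 1 ≤ n → ρ n ∈ scaledBetaFamily) ∧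
      (simpleLinearModel initRef q₀).NonstationaryConditions P X θ₀ δ uniformPrior ρ ∧
      ∃ ε : ℕ → ℝ, (∀ n, 1 ≤ n → 0 < ε n) ∧
        (∀ n, 1 ≤ n →
          (simpleLinearModel initRef q₀).PACBayesConditions θ₀ uniformPrior n (ρ n) (ε n)) ∧
        ε =O[atTop] fun n : ℕ => max (1 / √(n : ℝ)) ((n : ℝ) ^ (δ / 2) / n) := by
  have hθ : |θ₀| < 1 := by
    refine hθ₀.trans (Real.rpow_lt_one_of_one_lt_of_neg one_lt_two ?_)
    have : 1 / (4 + 2 * δ) < 1 := by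
      rw [div_lt_one (by positivity)]
      linarith
    linarith
  have hprob : IsProbabilityMeasure
      (initRef.withDensity fun x => ENNReal.ofReal (q₀ x)) := by
    rw [← hX₀.map_eq]
    exact Measure.isProbabilityMeasure_map hX₀.aemeasurable
  have hmom : Integrable (fun x => |x| ^ (4 + 2 * δ))
      (initRef.withDensity fun x => ENNReal.ofReal (q₀ x)) := by
    rw [← hX₀.map_eq]
    exact (integrable_map_measure (by fun_prop : Measurable _).aestronglyMeasurable
      hX₀.aemeasurable).2 hmoment
  have hmom4 : Integrable (fun x => |x| ^ (4 : ℝ))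
      (initRef.withDensity fun x => ENNReal.ofReal (q₀ x)) := by
    refine ((integrable_const 1).add hmom).mono'
      (by fun_prop : Measurable _).aestronglyMeasurable (ae_of_all _ fun x => ?_)
    rw [Real.norm_of_nonneg (by positivity)]
    change |x| ^ (4 : ℝ) ≤ 1 + |x| ^ (4 + 2 * δ)
    rcases le_total |x| 1 with h | h
    · have h1 := Real.rpow_le_one (abs_nonneg x) h (show (0 : ℝ) ≤ 4 by norm_num)
      have h2 : 0 ≤ |x| ^ (4 + 2 * δ) := by positivity
      linarith
    · have h1 := Real.rpow_le_rpow_of_exponent_le h (show (4 : ℝ) ≤ 4 + 2 * δ by linarith)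
      linarith
  obtain ⟨C, hC, hkl⟩ := exists_klDiv_concentratedBeta_le_sqrt hθ
  obtain ⟨K, hK, hS⟩ := exists_integral_sq_envelopeSum_le hθ _ hmom4
  refine ⟨fun n => concentratedBeta ((n : ℝ) ^ 4) θ₀, fun n hn => ?_, ?_,
    fun n => (C + (1 + K)) / √n, fun n hn => by positivity, fun n hn => ?_, ?_⟩
  · exact concentratedBeta_mem_scaledBetaFamily (by positivity) hθ
  · exact nonstationaryConditions_simpleLinearModel hδ hθ hq₀_nonneg hq₀ hprob hmom
      (hasLaw_chainLaw_of_linear_recursion hW hX₀ hW_indep hX_W hX)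
  · have hn' : (1 : ℝ) ≤ n := by exact_mod_cast hn
    have hs : 1 ≤ √(n : ℝ) := Real.one_le_sqrt.2 hn'
    have e : (n : ℝ) * ((C + (1 + K)) / √n) = (C + (1 + K)) * √n := by
      rw [mul_div_assoc', div_eq_iff (by positivity), mul_assoc, Real.mul_self_sqrt (by positivity)]
      ring
    refine pacBayesConditions_simpleLinearModel hθ hq₀ hprob hn hK (hS n).1 (hS n).2 ?_ ?_
    · rw [e]
      nlinarith
    · rw [e]
      refine (hkl n hn).trans (ENNReal.ofReal_le_ofReal ?_)
      gcongr
      linarith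
  · refine IsBigO.of_bound (C + (1 + K)) (Eventually.of_forall fun n => ?_)
    rw [Real.norm_of_nonneg (by positivity), Real.norm_of_nonneg (le_max_of_le_left (by positivity)),
      div_eq_mul_one_div]
    exact mul_le_mul_of_nonneg_left (le_max_left _ _) (by positivity)
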